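/- **Setting.** Let $d\ge 1$ be an integer, let $\mathcal F[f](t)=\int_{\mathbb R^d}e^{i\langle x,t\rangle}f(x)\,dx$ (extended to $L_2(\mathbb R^d)$), and let $\|\cdot\|$ be the norm of $L_2(\mathbb R^d)$ for functions and the Euclidean norm for vectors of $\mathbb R^d$. For $\beta,Q>0$ put $$\Theta(\beta,Q)=\Big\{p:\mathbb R^d\to\mathbb R \;\Big|\; p\ge 0,\ \int p=1,\ \int_{\mathbb R^d}\|t\|^{2\beta}\,|\mathcal F[p](t)|^2\,dt\le Q\Big\},$$ let $K_\beta$ be the Pinsker kernel, i.e. the (continuous) function with $\mathcal F[K_\beta](t)=(1-\|t\|^\beta)_+$, and let $$C^*=\frac{[Q(2\beta+d)]^{\frac{d}{2\beta+d}}}{d(2\pi)^d}\Big(\frac{\beta S_d}{\beta+d}\Big)^{\frac{2\beta}{2\beta+d}},\qquad S_d=\frac{2\pi^{d/2}}{\Gamma(d/2)} .$$ For an estimator $\hat p$ based on i.i.d. observations $X_1,\dots,X_n$ with density $p$, let $R_n(\hat p,p)=E\|\hat p-p\|^2$. **Aggregates of fixed functions.** Let $p_1,\dots,p_J\in L_2(\mathbb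 R^d)$ and observations $Y_1,\dots,Y_\ell$ be given. The linear aggregate is $\sum_k\hat\lambda_k\phi_k$, $\hat\lambda_k=\ell^{-1}\sum_{i=1}^{\ell}\phi_k(Y_i)$, where $(\phi_k)$ is an $L_2$-orthonormal basis of the linear span of $p_1,\dots,p_J$. The convex aggregate is $\sum_j\hat\lambda_jp_j$, where $\hat\lambda$ minimizes $\big\|\sum_j\lambda_jp_j\big\|^2-\frac2\ell\sum_{i=1}^{\ell}\sum_j\lambda_jp_j(Y_i)$ over $\{\lambda\in\mathbb R^J:\lambda_j\ge0,\ \sum_j\lambda_j\le1\}$. **The averaged kernel aggregate.** Fix $a_0>0$ and positive integers $N_n$ ($n\ge3$). Let $h_0=(n\log n)^{-1/d}$, $a_n=a_0/\log n$, $M-2=\max\{j\in\mathbb N: h_0(1+a_n)^j<1\}$, $h_j=(1+a_n)^jh_0$ for $j\le M-2$, $h_{M-1}=1$, and $\mathcal H=\{h_0,\dots,h_{M-1}\}$. Let $\mathcal B=\{\tfrac d2+(k-1)N_n^{-1/2}: k=1,\dots,N_n\}$. Put $m=\lfloor n(1-1/\log n)\rfloor$ and $\ell=n-m$, and fix, for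 each $n\ge3$, a nonempty finite set $\mathbf S_n$ of splits of $(X_1,\dots,X_n)$ into a training sample of size $m$ and a validation sample of size $\ell$. For each split, form from the training sample the kernel estimators $$x\mapsto\frac1{mh^d}\sum_{X_i\ \text{in training sample}}K_b\Big(\frac{X_i-x}{h}\Big),\qquad b\in\mathcal B,\ h\in\mathcal H,$$ and aggregate them (linearly or convexly) using the validation sample as observations. Let $\tilde p_n$ be the average of the resulting aggregates over all splits in $\mathbf S_n$. The construction does not depend on $\beta$ or $Q$ below. **Corollary 6.3.** Assume that $N_n\to\infty$ and $\limsup_{n\to\infty}N_n/(\log n)^\nu<\infty$ for some $\nu>0$. Then for every $d\ge1$, $\beta>d/2$ and $Q>0$, both the averaged linear and the averaged convex aggregate $\tilde p_n$ satisfy $$\sup_{p\in\Theta(\beta,Q)}R_n(\tilde p_n,p)\le C^*\,n^{-\frac{2\beta}{2\beta+d}}\,(1+o(1)),\qquad n\to\infty .$$ -/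

import Mathlib

open MeasureTheory Filter Topology

noncomputable section

namespace DensityAggregation

/-- The observation space: `ℝ^d` with the Euclidean norm. -/
abbrev E (d : ℕ) : Type := EuclideanSpace ℝ (Fin d)

/-! ### Sobolev classes of densities, risk -/

/-- The characteristic function `φ(t) = ∫ exp(i ⟨x, t⟩) p(x) dx` of an integrable `p`. -/
def charFunction {d : ℕ} (p : E d → ℝ) (t : E d) : ℂ :=
  ∫ x : E d, Complex.exp (Complex.I * ((inner ℝ x t : ℝ) : ℂ)) * ((p x : ℝ) : ℂ)

/-- The Sobolev class `Θ(β, Q)` of probability densities on `ℝ^d`.  (The condition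
`∫ p = 1` forces `p` to be integrable.) -/
def sobolevClass (d : ℕ) (β Q : ℝ) : Set (E d → ℝ) :=
  {p | (∀ x, 0 ≤ p x) ∧ ∫ x, p x = 1 ∧
    ∫⁻ t : E d, ENNReal.ofReal (‖t‖ ^ (2 * β) * ‖charFunction p t‖ ^ 2) ≤ ENNReal.ofReal Q}

/-- The law of an i.i.d. sample `(X_1, …, X_n)` with common density `p`. -/
def sampleLaw {d : ℕ} (n : ℕ) (p : E d → ℝ) : Measure (Fin n → E d) :=
  Measure.pi fun _ => (volume : Measure (E d)).withDensity fun x => ENNReal.ofReal (p x)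

/-- The mean integrated squared error `R_n(p̂, p) = E ‖p̂ - p‖²` of an estimator `p̂`,
which maps a sample to a function, as an extended nonnegative number. -/
def risk {d n : ℕ} (est : (Fin n → E d) → E d → ℝ) (p : E d → ℝ) : ENNReal :=
  ∫⁻ X : Fin n → E d, (∫⁻ x : E d, ENNReal.ofReal ((est X x - p x) ^ 2)) ∂(sampleLaw n p)

/-! ### Linear and convex aggregates of a finite family of fixed functions -/

/-- `φ_1, …, φ_r` is an orthonormal basis, in `L_2(ℝ^d)`, of the linear span of the
functions `p_j`.  The `φ_k` are honest functions (linear combinations of the `p_j`), so that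
they can be evaluated at the observations. -/
structure IsOrthonormalBasisOfSpan {d : ℕ} {ι : Type} (p : ι → E d → ℝ) {r : ℕ}
    (φ : Fin r → E d → ℝ) : Prop where
  mem_span : ∀ k, φ k ∈ Submodule.span ℝ (Set.range p)
  orthonormal : ∀ k l, ∫ x, φ k x * φ l x = if k = l then 1 else 0
  spans : ∀ j, ∃ g ∈ Submodule.span ℝ (Set.range φ), p j =ᵐ[volume] g

/-- Square integrable functions have an orthonormal basis of their linear span. -/
theorem exists_isOrthonormalBasisOfSpan {d : ℕ} {ι : Type} [Fintype ι] (p : ι → E d → ℝ)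
    (hp : ∀ j, MemLp (p j) 2 volume) :
    ∃ b : Σ r : ℕ, (Fin r → E d → ℝ), IsOrthonormalBasisOfSpan p b.2 := by
  classical
  let v : ι → Lp ℝ 2 (volume : Measure (E d)) := fun j => (hp j).toLp
  let V := Submodule.span ℝ (Set.range v)
  have : FiniteDimensional ℝ V := FiniteDimensional.span_of_finite ℝ (Set.finite_range v)
  let b := stdOrthonormalBasis ℝ V
  have hb : ∀ k, ∃ c : ι → ℝ, ∑ j, c j • v j = (b k : Lp ℝ 2 (volume : Measure (E d))) :=
    fun k => (Submodule.mem_span_range_iff_exists_fun ℝ).1 (b k).2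
  choose c hc using hb
  let φ : Fin (Module.finrank ℝ V) → E d → ℝ := fun k => ∑ j, c k j • p j
  have hφm : ∀ k, MemLp (φ k) 2 volume := fun k =>
    memLp_finsetSum' _ fun j _ => (hp j).const_smul (c k j)
  have hφ : ∀ k, (hφm k).toLp = (b k : Lp ℝ 2 (volume : Measure (E d))) := by
    intro k
    rw [← hc k]
    apply Lp.ext
    refine (MemLp.coeFn_toLp _).trans ?_
    have h1 := Lp.coeFn_finsetSum (Finset.univ) (fun j => c k j • v j)
    refine EventuallyEq.trans ?_ h1.symm
    have h2 : ∀ᵐ x : E d, ∀ j, (c k j • v j : Lp ℝ 2 (volume : Measure (E d))) x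
        = c k j • p j x := by
      rw [ae_all_iff]
      intro j
      filter_upwards [Lp.coeFn_smul (c k j) (v j), (hp j).coeFn_toLp] with x h3 h4
      rw [h3]
      simp [v, h4]
    filter_upwards [h2] with x hx
    simp [φ, hx]
  refine ⟨⟨_, φ⟩, ⟨?_, ?_, ?_⟩⟩
  · intro k
    exact Submodule.sum_mem _ fun j _ =>
      Submodule.smul_mem _ _ (Submodule.subset_span ⟨j, rfl⟩)
  · intro k l
    have h1 := (orthonormal_iff_ite.1 b.orthonormal) k l
    rw [Submodule.coe_inner, ← hφ k, ← hφ l, L2.inner_def] at h1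
    rw [← h1]
    refine integral_congr_ae ?_
    filter_upwards [(hφm k).coeFn_toLp, (hφm l).coeFn_toLp] with x h3 h4
    rw [h3, h4]
    simp [mul_comm]
  · intro j
    let w : V := ⟨v j, Submodule.subset_span ⟨j, rfl⟩⟩
    refine ⟨∑ k, inner ℝ (b k) w • φ k, Submodule.sum_mem _ fun k _ =>
      Submodule.smul_mem _ _ (Submodule.subset_span ⟨k, rfl⟩), ?_⟩
    have hs : ∑ k, inner ℝ (b k) w • (hφm k).toLp = v j := by
      have h1 := congrArg (Subtype.val) (b.sum_repr' w)
      simp only [hφ]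
      simpa [w] using h1
    have h1 := Lp.coeFn_finsetSum (Finset.univ) (fun k => inner ℝ (b k) w • (hφm k).toLp)
    rw [hs] at h1
    refine ((hp j).coeFn_toLp.symm.trans h1).trans ?_
    have h2 : ∀ᵐ x : E d, ∀ k, (inner ℝ (b k) w • (hφm k).toLp :
        Lp ℝ 2 (volume : Measure (E d))) x = inner ℝ (b k) w • φ k x := by
      rw [ae_all_iff]
      intro k
      filter_upwards [Lp.coeFn_smul (inner ℝ (b k) w) ((hφm k).toLp), (hφm k).coeFn_toLp]
        with x h3 h4
      rw [h3]
      simp [h4]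
    filter_upwards [h2] with x hx
    simp only [Finset.sum_apply, Pi.smul_apply, hx]

/-- An orthonormal basis of the span of the `p_j`, together with its length. It exists as
soon as the `p_j` are in `L_2`, see `exists_isOrthonormalBasisOfSpan`. -/
def spanBasis {d : ℕ} {ι : Type} (p : ι → E d → ℝ) : Σ r : ℕ, (Fin r → E d → ℝ) :=
  @Classical.epsilon _ ⟨⟨0, fun _ _ => 0⟩⟩ fun b => IsOrthonormalBasisOfSpan p b.2

/-- The linear aggregate of the functions `p_j` based on the observations `Y_1, …, Y_ℓ`:
the function `∑_k λ̂_k φ_k` with `λ̂_k = ℓ⁻¹ ∑_i φ_k(Y_i)`, where the `φ_k` form an orthonormal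
basis of the linear span of the `p_j`. -/
def linearAggregate {d : ℕ} {ι : Type} {l : ℕ} (p : ι → E d → ℝ) (Y : Fin l → E d)
    (x : E d) : ℝ :=
  ∑ k, ((l : ℝ)⁻¹ * ∑ i, (spanBasis p).2 k (Y i)) * (spanBasis p).2 k x

/-- The set `Λ` of weights: `λ_j ≥ 0` and `∑ λ_j ≤ 1`. -/
def subSimplex (ι : Type) [Fintype ι] : Set (ι → ℝ) :=
  {w | (∀ j, 0 ≤ w j) ∧ ∑ j, w j ≤ 1}

/-- The empirical criterion `‖p_λ‖² - (2/ℓ) ∑_i p_λ(Y_i)`, where `p_λ = ∑_j λ_j p_j`. -/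
def empiricalCriterion {d : ℕ} {ι : Type} [Fintype ι] {l : ℕ} (p : ι → E d → ℝ)
    (Y : Fin l → E d) (w : ι → ℝ) : ℝ :=
  (∫ x, (∑ j, w j * p j x) ^ 2) - 2 / (l : ℝ) * ∑ i, ∑ j, w j * p j (Y i)

/-- The empirical criterion of square integrable functions has a minimizer over `Λ`. -/
theorem exists_convexWeights {d : ℕ} {ι : Type} [Fintype ι] {l : ℕ} (p : ι → E d → ℝ)
    (hp : ∀ j, MemLp (p j) 2 volume) (Y : Fin l → E d) :
    ∃ w, IsMinOn (empiricalCriterion p Y) (subSimplex ι) w ∧ w ∈ subSimplex ι := by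
  have hcpt : IsCompact (subSimplex ι) := by
    refine (isCompact_univ_pi fun _ : ι => isCompact_Icc (a := (0 : ℝ)) (b := 1)).of_isClosed_subset
      ?_ ?_
    · have h1 : IsClosed (⋂ j, {w : ι → ℝ | 0 ≤ w j}) :=
        isClosed_iInter fun j => isClosed_le continuous_const (continuous_apply j)
      have h2 : IsClosed {w : ι → ℝ | ∑ j, w j ≤ 1} :=
        isClosed_le (by fun_prop) continuous_const
      convert h1.inter h2 using 1
      ext w
      simp [subSimplex]
    · intro w hw j _
      exact ⟨hw.1 j, (Finset.single_le_sum (fun i _ => hw.1 i) (Finset.mem_univ j)).trans hw.2⟩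
  have hcont : Continuous (empiricalCriterion p Y) := by
    have h : empiricalCriterion p Y = fun w => (∑ i, ∑ j, w i * w j * ∫ x, p i x * p j x)
        - 2 / (l : ℝ) * ∑ i, ∑ j, w j * p j (Y i) := by
      funext w
      unfold empiricalCriterion
      congr 1
      have h1 : ∀ i j, Integrable (fun x => w i * w j * (p i x * p j x)) := fun i j =>
        ((hp i).integrable_mul (hp j)).const_mul _
      simp_rw [← integral_const_mul]
      have h2 : ∀ i, ∑ j, ∫ x, w i * w j * (p i x * p j x)
          = ∫ x, ∑ j, w i * w j * (p i x * p j x) := fun i =>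
        (integral_finsetSum _ fun j _ => h1 i j).symm
      simp_rw [h2]
      rw [← integral_finsetSum _ fun i _ => integrable_finsetSum _ fun j _ => h1 i j]
      congr 1
      funext x
      rw [sq, Finset.sum_mul_sum]
      refine Finset.sum_congr rfl fun i _ => Finset.sum_congr rfl fun j _ => by ring
    rw [h]
    fun_prop
  obtain ⟨w, hw, hmin⟩ := hcpt.exists_isMinOn ⟨0, by simp [subSimplex]⟩ hcont.continuousOn
  exact ⟨w, hmin, hw⟩

/-- A minimizer of the empirical criterion over `Λ`. It exists as soon as the `p_j` are in
`L_2`, see `exists_convexWeights`. -/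
def convexWeights {d : ℕ} {ι : Type} [Fintype ι] {l : ℕ} (p : ι → E d → ℝ)
    (Y : Fin l → E d) : ι → ℝ :=
  Classical.epsilon fun w =>
    IsMinOn (empiricalCriterion p Y) (subSimplex ι) w ∧ w ∈ subSimplex ι

/-- The convex aggregate `∑_j λ̂_j p_j` of the functions `p_j` based on `Y_1, …, Y_ℓ`. -/
def convexAggregate {d : ℕ} {ι : Type} [Fintype ι] {l : ℕ} (p : ι → E d → ℝ)
    (Y : Fin l → E d) (x : E d) : ℝ :=
  ∑ j, convexWeights p Y j * p j x

/-! ### Pinsker kernels and kernel estimators -/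

/-- The Pinsker kernel `K_β`: the kernel whose Fourier transform `∫ exp(i ⟨x, t⟩) K_β(x) dx`
is `(1 - ‖t‖^β)_+`, i.e. the inverse Fourier transform of that (real, even, integrable)
function. -/
def pinskerKernel (d : ℕ) (β : ℝ) (x : E d) : ℝ :=
  ((2 * Real.pi) ^ d)⁻¹ *
    (∫ t : E d, Complex.exp (-(Complex.I * ((inner ℝ t x : ℝ) : ℂ))) *
      ((max (1 - ‖t‖ ^ β) 0 : ℝ) : ℂ)).re

/-- The kernel density estimator `(m h^d)⁻¹ ∑_i K((Y_i - x) / h)`. -/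
def kernelEstimator {d m : ℕ} (K : E d → ℝ) (h : ℝ) (Y : Fin m → E d) (x : E d) : ℝ :=
  ((m : ℝ) * h ^ d)⁻¹ * ∑ i, K (h⁻¹ • (Y i - x))

/-- The smallest bandwidth `h_0 = (n log n)^(-1/d)`. -/
def h0 (d n : ℕ) : ℝ := ((n : ℝ) * Real.log n) ^ (-1 / (d : ℝ))

/-- The ratio `1 + a_n`, `a_n = a_0 / log n`, of successive bandwidths. -/
def gridRatio (a₀ : ℝ) (n : ℕ) : ℝ := 1 + a₀ / Real.log n

/-- The number `M - 2 = max {j : h_0 (1 + a_n)^j < 1}`. -/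
def lastIndex (d : ℕ) (a₀ : ℝ) (n : ℕ) : ℕ :=
  sSup {j : ℕ | h0 d n * gridRatio a₀ n ^ j < 1}

/-- The number `M` of bandwidths. -/
def numBandwidths (d : ℕ) (a₀ : ℝ) (n : ℕ) : ℕ := lastIndex d a₀ n + 2

/-- The bandwidths `h_j = (1 + a_n)^j h_0` for `0 ≤ j ≤ M - 2`, and `h_{M-1} = 1`. -/
def bandwidth (d : ℕ) (a₀ : ℝ) (n : ℕ) (j : Fin (numBandwidths d a₀ n)) : ℝ :=
  if (j : ℕ) ≤ lastIndex d a₀ n then gridRatio a₀ n ^ (j : ℕ) * h0 d n else 1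

/-- The grid `d/2, d/2 + N^(-1/2), d/2 + 2 N^(-1/2), …` of `N` smoothness indices. -/
def smoothnessGrid (d N : ℕ) (k : Fin N) : ℝ := (d : ℝ) / 2 + (k : ℕ) * (N : ℝ) ^ (-(1 / 2 : ℝ))

/-! ### Sample splitting and the averaged kernel aggregate -/

/-- The size `m = ⌊n (1 - 1 / log n)⌋` of the training sample. -/
def trainSize (n : ℕ) : ℕ := ⌊(n : ℝ) * (1 - (Real.log n)⁻¹)⌋₊

/-- A split of a sample of size `n` into a training sample of size `m` and a validation sample
of size `ℓ = n - m`, given by the positions of their members in the original sample. -/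
abbrev Split (n : ℕ) : Type := Fin (trainSize n) ⊕ Fin (n - trainSize n) ≃ Fin n

/-- The training sample of a split. -/
def trainSample {d n : ℕ} (s : Split n) (X : Fin n → E d) : Fin (trainSize n) → E d :=
  fun i => X (s (Sum.inl i))

/-- The validation sample of a split. -/
def validSample {d n : ℕ} (s : Split n) (X : Fin n → E d) : Fin (n - trainSize n) → E d :=
  fun i => X (s (Sum.inr i))

/-- The `N * M` initial estimators: the kernel estimators built from the training sample `Y`
with Pinsker kernels `K_b`, `b` in the smoothness grid, and `h` in the bandwidth grid. -/
def initialEstimators (d : ℕ) (a₀ : ℝ) (n N : ℕ) {m : ℕ} (Y : Fin m → E d)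
    (j : Fin N × Fin (numBandwidths d a₀ n)) : E d → ℝ :=
  kernelEstimator (pinskerKernel d (smoothnessGrid d N j.1)) (bandwidth d a₀ n j.2) Y

/-- The averaged linear kernel aggregate over a set `S` of splits. -/
def averagedLinearAggregate (d : ℕ) (a₀ : ℝ) (n N : ℕ) (S : Finset (Split n))
    (X : Fin n → E d) (x : E d) : ℝ :=
  (S.card : ℝ)⁻¹ * ∑ s ∈ S,
    linearAggregate (initialEstimators d a₀ n N (trainSample s X)) (validSample s X) x

/-- The averaged convex kernel aggregate over a set `S` of splits. -/
def averagedConvexAggregate (d : ℕ) (a₀ : ℝ) (n N : ℕ) (S : Finset (Split n))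
    (X : Fin n → E d) (x : E d) : ℝ :=
  (S.card : ℝ)⁻¹ * ∑ s ∈ S,
    convexAggregate (initialEstimators d a₀ n N (trainSample s X)) (validSample s X) x

/-! ### The constant -/

/-- The surface `S_d = 2 π^(d/2) / Γ(d/2)` of the unit sphere of `ℝ^d`. -/
def sphereSurface (d : ℕ) : ℝ :=
  2 * Real.pi ^ ((d : ℝ) / 2) / Real.Gamma ((d : ℝ) / 2)

/-- The constant `C*`, with
`C* = (Q (2β + d))^(d / (2β + d)) / (d (2π)^d) * (β S_d / (β + d))^(2β / (2β + d))`. -/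
def pinskerConstant (d : ℕ) (β Q : ℝ) : ℝ :=
  (Q * (2 * β + d)) ^ ((d : ℝ) / (2 * β + d)) / (d * (2 * Real.pi) ^ d) *
    (β * sphereSurface d / (β + d)) ^ (2 * β / (2 * β + d))

/-- `r_n ≤ C n^(-γ) (1 + o(1))` as `n → ∞`. -/
def AsymptoticallyLE (r : ℕ → ENNReal) (C γ : ℝ) : Prop :=
  ∃ ε : ℕ → ℝ, Tendsto ε atTop (𝓝 0) ∧
    ∀ᶠ n : ℕ in atTop, r n ≤ ENNReal.ofReal (C * (n : ℝ) ^ (-γ) * (1 + ε n))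

end DensityAggregation

end

noncomputable section

namespace DensityAggregation

section

open scoped FourierTransform ContDiff SchwartzMap

/-! ### Fourier analysis: Plancherel and inversion for integrable functions -/

/-! The constant `C*` already comes out of a single kernel estimator; aggregation only has to find
that estimator at negligible cost.

Single estimator. By Plancherel, the Pinsker kernel `K_b` with bandwidth `h` has squared bias
governed by `1 - (1 - ‖ht‖^b)_+`, which is at most `‖ht‖^β` as soon as `b ≥ β`. Hence over the whole
class the squared bias is at most `(2π)^{-d} h^{2β} Q`, and the variance is at most `(2π)^{-d} (m
h^d)⁻¹ ∫ (1 - ‖t‖^b)_+² dt` (`risk_kernelEstimator_le`). At `b = β`, `m = n`, the minimum of the sum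
over `h` is exactly `C* n^{-2β/(2β+d)}` (`pinskerConstant_eq`). The grids contain some `b ≥ β`
tending to `β` and some `h` within the factor `1 + a_n → 1` below the optimum, and `m/n → 1`, so the
constant survives.

Aggregation. Both aggregates `g` of `q_1, …, q_J` satisfy `⟨g, g - q_j⟩ ≤ ℓ⁻¹ ∑ (g - q_j)(Y_i)`:
with equality for the linear one, by the first order condition for the convex one. Expanding squares
gives `‖g - p‖² ≤ ‖q_j - p‖² + 2 (P_ℓ - P)(g - q_j) - ‖g - q_j‖²`, where `P_ℓ` is the empirical and
`P` the true mean. The last two terms are at most their supremum over the span, whose expectation is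
at most `L J / ℓ` when `p ≤ L` (`lintegral_excessSup_le`). Thus the oracle inequality has leading
constant one.

A uniform `L` exists because `β > d/2` makes the characteristic functions of the class uniformly
integrable in `L_1` norm. Here `J = N M` is polylogarithmic and `ℓ ≥ n / log n`, so the remainder is
`o(n^{-2β/(2β+d)})`. Averaging over splits costs nothing, by convexity of the square. -/

theorem continuous_fourier {d : ℕ} {f : E d → ℂ} (hf : Integrable f) : Continuous (𝓕 f) :=
  VectorFourier.fourierIntegral_continuous (L := innerₗ (E d)) Real.continuous_fourierChar
    continuous_inner hf

theorem integral_fourier_mul {d : ℕ} {f g : E d → ℂ} (hf : Integrable f) (hg : Integrable g) :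
    ∫ x, 𝓕 f x * g x = ∫ x, f x * 𝓕 g x := by
  simpa using! VectorFourier.integral_fourierIntegral_smul_eq_flip (L := innerₗ (E d))
    Real.continuous_fourierChar continuous_inner hf hg

/-- Smooth compactly supported functions are Schwartz, and they already separate locally integrable
functions. -/
theorem ae_eq_of_integral_schwartz_mul_eq {d : ℕ} {f f' : E d → ℂ}
    (hf : LocallyIntegrable f) (hf' : LocallyIntegrable f')
    (h : ∀ g : 𝓢(E d, ℂ), ∫ x, g x * f x = ∫ x, g x * f' x) : f =ᵐ[volume] f' := by
  refine ae_eq_of_integral_contDiff_smul_eq hf hf' fun g hg hgc => ?_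
  have h1 : HasCompactSupport (fun x => (g x : ℂ)) := hgc.comp_left (g := fun x : ℝ => (x : ℂ)) rfl
  have h2 : ContDiff ℝ ∞ (fun x => (g x : ℂ)) := Complex.ofRealCLM.contDiff.comp hg
  have := h (h1.toSchwartzMap h2)
  simpa using this

/-- Both transforms represent the same tempered distribution: against a Schwartz function, each
moves onto the test function. -/
theorem coeFn_fourier_toLp {d : ℕ} {f : E d → ℂ} (hf : Integrable f) (hf2 : MemLp f 2) :
    (𝓕 (hf2.toLp) : Lp ℂ 2 (volume : Measure (E d))) =ᵐ[volume] 𝓕 f := by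
  refine ae_eq_of_integral_schwartz_mul_eq ?_ (continuous_fourier hf).locallyIntegrable ?_
  · exact (Lp.memLp _).locallyIntegrable (by norm_num)
  · intro g
    have h1 := congrArg (fun T => T g) (Lp.fourier_toTemperedDistribution_eq hf2.toLp)
    simp only [TemperedDistribution.fourier_apply, Lp.toTemperedDistribution_apply,
      smul_eq_mul] at h1
    rw [← h1]
    have h2 := integral_fourier_mul (f := g) g.integrable hf
    rw [← h2]
    refine integral_congr_ae ?_
    filter_upwards [hf2.coeFn_toLp] with x hx
    rw [hx, SchwartzMap.fourier_coe]

/-- **Plancherel's theorem** for integrable, square integrable functions. -/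
theorem lintegral_enorm_fourier_sq {d : ℕ} {f : E d → ℂ} (hf : Integrable f)
    (hf2 : MemLp f 2) : ∫⁻ x, ‖𝓕 f x‖ₑ ^ 2 = ∫⁻ x, ‖f x‖ₑ ^ 2 := by
  have h := Lp.norm_fourier_eq hf2.toLp
  have h' : ‖(𝓕 (hf2.toLp) : Lp ℂ 2 (volume : Measure (E d)))‖ₑ = ‖hf2.toLp‖ₑ := by
    rw [← ofReal_norm, ← ofReal_norm, h]
  rw [Lp.enorm_def, Lp.enorm_def, eLpNorm_congr_ae (coeFn_fourier_toLp hf hf2),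
    eLpNorm_congr_ae hf2.coeFn_toLp] at h'
  have key : ∀ g : E d → ℂ, ∫⁻ x, ‖g x‖ₑ ^ 2 = eLpNorm g 2 volume ^ 2 := by
    intro g
    rw [← ENNReal.rpow_natCast,
      show ((2 : ℕ) : ℝ) = ((2 : NNReal) : ℝ) by norm_num]
    have := eLpNorm_nnreal_pow_eq_lintegral (f := g) (p := 2) (μ := volume) (by norm_num)
    rw [show ((2 : NNReal) : ENNReal) = 2 by norm_num] at this
    rw [this]
    simp
  rw [key, key, h']

/-- **Fourier inversion** almost everywhere, without continuity. -/
theorem fourierInv_fourier_ae_eq {d : ℕ} {f : E d → ℂ} (hf : Integrable f)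
    (hf' : Integrable (𝓕 f)) : 𝓕⁻ (𝓕 f) =ᵐ[volume] f := by
  have hc : Continuous (𝓕⁻ (𝓕 f)) := by
    have : 𝓕⁻ (𝓕 f) = fun x => 𝓕 (𝓕 f) (-x) := by
      funext x; exact Real.fourierInv_eq_fourier_neg _ _
    rw [this]
    exact (continuous_fourier hf').comp continuous_neg
  refine ae_eq_of_integral_schwartz_mul_eq hc.locallyIntegrable hf.locallyIntegrable ?_
  intro g
  -- Writing the test function as a transform `𝓕 k` lets every transform be moved onto `k`, where
  -- classical inversion applies.
  obtain ⟨k, rfl⟩ : ∃ k : 𝓢(E d, ℂ), 𝓕 k = g := ⟨𝓕⁻ g, by simp⟩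
  have h2 := integral_fourier_mul (f := k) k.integrable hf
  rw [SchwartzMap.fourier_coe, h2]
  have h3 : ∀ x, 𝓕⁻ (𝓕 f) x = 𝓕 (fun y => 𝓕 f (-y)) x := by
    intro x; rw [Real.fourierInv_eq_fourier_comp_neg]
  simp_rw [h3]
  have hf'' : Integrable (fun y => 𝓕 f (-y)) := hf'.comp_neg
  have hk : Integrable (𝓕 (k : E d → ℂ)) := by
    rw [← SchwartzMap.fourier_coe]; exact (𝓕 k).integrable
  rw [← integral_fourier_mul hk hf'']
  rw [← integral_neg_eq_self]
  refine integral_congr_ae (ae_of_all _ fun x => ?_)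
  simp only [neg_neg]
  rw [← Real.fourierInv_eq_fourier_neg, k.continuous.fourierInv_fourier_eq k.integrable hk]

end

section

open scoped FourierTransform

/-! ### Bounded versions of the densities of a Sobolev class -/

theorem lintegral_comp_smul {d : ℕ} (f : E d → ENNReal) {c : ℝ} (hc : c ≠ 0) :
    ∫⁻ x, f (c • x) = ENNReal.ofReal |(c ^ d)⁻¹| * ∫⁻ x, f x := by
  have h := Measure.map_addHaar_smul (volume : Measure (E d)) hc
  rw [finrank_euclideanSpace_fin] at h
  have he : MeasurableEmbedding fun x : E d => c • x :=
    (Homeomorph.smulOfNeZero c hc).measurableEmbedding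
  rw [← he.lintegral_map (μ := volume) f, h, lintegral_smul_measure, smul_eq_mul]

theorem fourier_eq_charFunction {d : ℕ} (p : E d → ℝ) (ξ : E d) :
    𝓕 (fun x => (p x : ℂ)) ξ = charFunction p (-(2 * Real.pi) • ξ) := by
  rw [Real.fourier_eq', charFunction]
  refine integral_congr_ae (ae_of_all _ fun x => ?_)
  simp only [smul_eq_mul, inner_smul_right]
  push_cast
  ring_nf

theorem norm_fourier_le_integral_norm {d : ℕ} (f : E d → ℂ) (ξ : E d) :
    ‖𝓕 f ξ‖ ≤ ∫ x, ‖f x‖ :=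
  VectorFourier.norm_fourierIntegral_le_integral_norm _ _ _ _ _

theorem norm_fourierInv_le_integral_norm {d : ℕ} (f : E d → ℂ) (ξ : E d) :
    ‖𝓕⁻ f ξ‖ ≤ ∫ x, ‖f x‖ := by
  rw [Real.fourierInv_eq_fourier_neg]
  exact norm_fourier_le_integral_norm _ _

variable {d : ℕ} {β Q : ℝ} {p : E d → ℝ}

theorem integrable_of_mem_sobolevClass (hp : p ∈ sobolevClass d β Q) : Integrable p := by
  by_contra h
  have := hp.2.1
  rw [integral_undef h] at this
  exact zero_ne_one this

theorem norm_fourier_le_one_of_mem_sobolevClass (hp : p ∈ sobolevClass d β Q) (ξ : E d) :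
    ‖𝓕 (fun x => (p x : ℂ)) ξ‖ ≤ 1 := by
  refine (norm_fourier_le_integral_norm _ _).trans (le_of_eq ?_)
  rw [← hp.2.1]
  refine integral_congr_ae (ae_of_all _ fun x => ?_)
  simp [abs_of_nonneg (hp.1 x)]

theorem lintegral_rpow_mul_fourier_sq_le (hp : p ∈ sobolevClass d β Q) :
    ∫⁻ ξ, ENNReal.ofReal (‖ξ‖ ^ (2 * β) * ‖𝓕 (fun x => (p x : ℂ)) ξ‖ ^ 2) ≤
      ENNReal.ofReal (((2 * Real.pi) ^ (2 * β) * (2 * Real.pi) ^ d)⁻¹ * Q) := by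
  have hpi : (0 : ℝ) < 2 * Real.pi := by positivity
  have h1 : ∀ ξ : E d, ENNReal.ofReal (‖ξ‖ ^ (2 * β) * ‖𝓕 (fun x => (p x : ℂ)) ξ‖ ^ 2) =
      ENNReal.ofReal ((2 * Real.pi) ^ (2 * β))⁻¹ * (fun t : E d => ENNReal.ofReal
        (‖t‖ ^ (2 * β) * ‖charFunction p t‖ ^ 2)) (-(2 * Real.pi) • ξ) := by
    intro ξ
    rw [← ENNReal.ofReal_mul (by positivity), fourier_eq_charFunction]
    congr 1
    rw [norm_smul, norm_neg, Real.norm_of_nonneg hpi.le, Real.mul_rpow hpi.le (norm_nonneg _)]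
    field_simp
  rw [lintegral_congr h1, lintegral_const_mul' _ _ ENNReal.ofReal_ne_top,
    lintegral_comp_smul (fun t : E d => ENNReal.ofReal
      (‖t‖ ^ (2 * β) * ‖charFunction p t‖ ^ 2)) (by linarith)]
  refine (mul_le_mul_right (mul_le_mul_right hp.2.2 _) _).trans (le_of_eq ?_)
  rw [← ENNReal.ofReal_mul (abs_nonneg _), ← ENNReal.ofReal_mul (by positivity)]
  congr 1
  rw [abs_inv, abs_pow, abs_neg, abs_of_pos hpi, mul_inv]
  ring

/-- A bound for the densities in a Sobolev class. -/
def sobolevSupBound (d : ℕ) (β Q : ℝ) : ℝ :=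
  (∫ ξ : E d, 2 ^ (2 * β) * (1 + ‖ξ‖) ^ (-(2 * β))) +
    ((2 * Real.pi) ^ (2 * β) * (2 * Real.pi) ^ d)⁻¹ * Q

theorem sobolevSupBound_nonneg (hQ : 0 < Q) : 0 ≤ sobolevSupBound d β Q := by
  unfold sobolevSupBound
  have : 0 ≤ ∫ ξ : E d, 2 ^ (2 * β) * (1 + ‖ξ‖) ^ (-(2 * β)) :=
    integral_nonneg fun ξ => by positivity
  positivity

/-- With `s = r^{2β}`, either `y ≤ 1/s` or `y ≤ s y²`. The factor `(2/(1+r))^{2β}` dominates `1/s`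
for `r ≥ 1` and the trivial bound `1` for `r ≤ 1`, and is integrable on `ℝ^d` when `2β > d`. -/
theorem le_add_rpow_mul_sq {β r y : ℝ} (hβ : 0 < β) (hr : 0 ≤ r) (hy : 0 ≤ y) (hy1 : y ≤ 1) :
    y ≤ 2 ^ (2 * β) * (1 + r) ^ (-(2 * β)) + r ^ (2 * β) * y ^ 2 := by
  have h2 : 0 ≤ r ^ (2 * β) * y ^ 2 := by positivity
  have h3 : (2 : ℝ) ^ (2 * β) * (1 + r) ^ (-(2 * β)) = (2 / (1 + r)) ^ (2 * β) := by
    rw [Real.rpow_neg (by positivity), Real.div_rpow (by norm_num) (by positivity)]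
    rfl
  rw [h3]
  rcases le_total r 1 with h | h
  · have : (1 : ℝ) ≤ (2 / (1 + r)) ^ (2 * β) := by
      apply Real.one_le_rpow _ (by positivity)
      rw [le_div_iff₀ (by positivity)]; linarith
    linarith
  · have h4 : (1 / r) ^ (2 * β) ≤ (2 / (1 + r)) ^ (2 * β) := by
      apply Real.rpow_le_rpow (by positivity) _ (by positivity)
      rw [div_le_div_iff₀ (by positivity) (by positivity)]; linarith
    rw [Real.div_rpow (by norm_num) hr, Real.one_rpow] at h4
    have h5 : 0 < r ^ (2 * β) := by positivity
    set s := r ^ (2 * β)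
    rcases le_total y (1 / s) with h6 | h6
    · linarith
    · have : y ≤ s * y ^ 2 := by
        rw [div_le_iff₀ h5] at h6
        nlinarith
      have : 0 ≤ 1 / s := by positivity
      linarith

theorem lintegral_enorm_fourier_le (hβ : (d : ℝ) / 2 < β) (hQ : 0 < Q)
    (hp : p ∈ sobolevClass d β Q) :
    ∫⁻ ξ, ‖𝓕 (fun x => (p x : ℂ)) ξ‖ₑ ≤ ENNReal.ofReal (sobolevSupBound d β Q) := by
  have hβ0 : 0 < β := lt_of_le_of_lt (by positivity) hβ
  have hint : Integrable fun ξ : E d => (2 : ℝ) ^ (2 * β) * (1 + ‖ξ‖) ^ (-(2 * β)) := by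
    refine (integrable_one_add_norm ?_).const_mul _
    rw [finrank_euclideanSpace_fin]; linarith
  have h1 : ∀ ξ : E d, ‖𝓕 (fun x => (p x : ℂ)) ξ‖ₑ ≤
      ENNReal.ofReal (2 ^ (2 * β) * (1 + ‖ξ‖) ^ (-(2 * β))) +
        ENNReal.ofReal (‖ξ‖ ^ (2 * β) * ‖𝓕 (fun x => (p x : ℂ)) ξ‖ ^ 2) := by
    intro ξ
    rw [← ENNReal.ofReal_add (by positivity) (by positivity), ← ofReal_norm]
    exact ENNReal.ofReal_le_ofReal (le_add_rpow_mul_sq hβ0 (norm_nonneg _) (norm_nonneg _)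
      (norm_fourier_le_one_of_mem_sobolevClass hp ξ))
  refine (lintegral_mono h1).trans ?_
  rw [lintegral_add_left' hint.aestronglyMeasurable.aemeasurable.ennreal_ofReal,
    sobolevSupBound, ENNReal.ofReal_add (integral_nonneg fun ξ => by positivity) (by positivity),
    ofReal_integral_eq_lintegral_ofReal hint (ae_of_all _ fun ξ => by positivity)]
  gcongr
  exact lintegral_rpow_mul_fourier_sq_le hp

theorem integrable_fourier_of_mem_sobolevClass (hβ : (d : ℝ) / 2 < β) (hQ : 0 < Q)
    (hp : p ∈ sobolevClass d β Q) : Integrable (𝓕 (fun x => (p x : ℂ))) :=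
  ⟨(continuous_fourier (integrable_of_mem_sobolevClass hp).ofReal).aestronglyMeasurable,
    (lintegral_enorm_fourier_le hβ hQ hp).trans_lt ENNReal.ofReal_lt_top⟩

theorem ae_le_sobolevSupBound (hβ : (d : ℝ) / 2 < β) (hQ : 0 < Q)
    (hp : p ∈ sobolevClass d β Q) : ∀ᵐ x, p x ≤ sobolevSupBound d β Q := by
  have hF := integrable_fourier_of_mem_sobolevClass hβ hQ hp
  filter_upwards [fourierInv_fourier_ae_eq (integrable_of_mem_sobolevClass hp).ofReal hF]
    with x hx
  have h1 : ∫ ξ, ‖𝓕 (fun x => (p x : ℂ)) ξ‖ ≤ sobolevSupBound d β Q := by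
    have := lintegral_enorm_fourier_le hβ hQ hp
    rw [← ofReal_integral_norm_eq_lintegral_enorm hF] at this
    exact (ENNReal.ofReal_le_ofReal_iff (sobolevSupBound_nonneg hQ)).1 this
  refine le_trans ?_ ((norm_fourierInv_le_integral_norm _ x).trans h1)
  erw [hx]
  simpa using le_abs_self (p x)

/-- Measurable probability densities bounded by `L`. -/
structure IsBoundedDensity (p : E d → ℝ) (L : ℝ) : Prop where
  measurable : Measurable p
  nonneg : ∀ x, 0 ≤ p x
  le : ∀ x, p x ≤ L
  integral_eq_one : ∫ x, p x = 1

theorem charFunction_congr_ae {p q : E d → ℝ} (h : p =ᵐ[volume] q) (t : E d) :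
    charFunction p t = charFunction q t := by
  refine integral_congr_ae ?_
  filter_upwards [h] with x hx
  rw [hx]

theorem risk_congr_ae {n : ℕ} (est : (Fin n → E d) → E d → ℝ) {p q : E d → ℝ}
    (h : p =ᵐ[volume] q) : risk est p = risk est q := by
  have h1 : sampleLaw n p = sampleLaw n q := by
    unfold sampleLaw
    congr 1
    funext _
    refine withDensity_congr_ae ?_
    filter_upwards [h] with x hx
    rw [hx]
  unfold risk
  rw [h1]
  congr 1
  funext X
  refine lintegral_congr_ae ?_
  filter_upwards [h] with x hx
  rw [hx]

/-- Membership in the class requires neither Borel measurability nor a pointwise bound. The risk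
depends only on the almost everywhere class, so a clamped measurable representative may replace `p`.
-/
theorem exists_isBoundedDensity_ae_eq (hβ : (d : ℝ) / 2 < β) (hQ : 0 < Q)
    (hp : p ∈ sobolevClass d β Q) :
    ∃ q ∈ sobolevClass d β Q, p =ᵐ[volume] q ∧ IsBoundedDensity q (sobolevSupBound d β Q) := by
  have hpm := (integrable_of_mem_sobolevClass hp).aestronglyMeasurable
  let L := sobolevSupBound d β Q
  let q : E d → ℝ := fun x => max 0 (min L (hpm.mk p x))
  have hq : p =ᵐ[volume] q := by
    filter_upwards [hpm.ae_eq_mk, ae_le_sobolevSupBound hβ hQ hp] with x h1 h2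
    simp only [q]
    rw [← h1, min_eq_right h2, max_eq_right (hp.1 x)]
  have hint : ∫ x, q x = 1 := by rw [← integral_congr_ae hq, hp.2.1]
  have hq0 : ∀ x, 0 ≤ q x := fun x => le_max_left _ _
  refine ⟨q, ⟨hq0, hint, ?_⟩, hq, ?_, hq0, ?_, hint⟩
  · have := hp.2.2
    simpa only [charFunction_congr_ae hq] using this
  · exact measurable_const.max (measurable_const.min hpm.stronglyMeasurable_mk.measurable)
  · exact fun x => max_le (sobolevSupBound_nonneg hQ) (min_le_left _ _)

/-! ### The law of an observation -/

/-- The law with density `p`. -/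
def densityMeasure (p : E d → ℝ) : Measure (E d) :=
  volume.withDensity fun x => ENNReal.ofReal (p x)

namespace IsBoundedDensity

variable {L : ℝ} (hp : IsBoundedDensity p L)
include hp

theorem integrable : Integrable p := by
  by_contra h
  have := hp.integral_eq_one
  rw [integral_undef h] at this
  exact zero_ne_one this

theorem isProbabilityMeasure : IsProbabilityMeasure (densityMeasure p) := by
  constructor
  rw [densityMeasure, withDensity_apply _ MeasurableSet.univ, Measure.restrict_univ,
    ← ofReal_integral_eq_lintegral_ofReal hp.integrable (ae_of_all _ hp.nonneg),
    hp.integral_eq_one, ENNReal.ofReal_one]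

theorem bound_nonneg : 0 ≤ L := (hp.nonneg 0).trans (hp.le 0)

theorem lintegral_densityMeasure (f : E d → ENNReal) :
    ∫⁻ x, f x ∂densityMeasure p = ∫⁻ x, ENNReal.ofReal (p x) * f x := by
  rw [densityMeasure, lintegral_withDensity_eq_lintegral_mul_non_measurable _
    hp.measurable.ennreal_ofReal (ae_of_all _ fun x => ENNReal.ofReal_lt_top)]
  rfl

theorem integral_densityMeasure (f : E d → ℝ) :
    ∫ x, f x ∂densityMeasure p = ∫ x, p x * f x := by
  rw [densityMeasure, integral_withDensity_eq_integral_toReal_smul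
    hp.measurable.ennreal_ofReal (ae_of_all _ fun x => ENNReal.ofReal_lt_top)]
  refine integral_congr_ae (ae_of_all _ fun x => ?_)
  simp [ENNReal.toReal_ofReal (hp.nonneg x)]

theorem lintegral_densityMeasure_le (f : E d → ENNReal) :
    ∫⁻ x, f x ∂densityMeasure p ≤ ENNReal.ofReal L * ∫⁻ x, f x := by
  rw [hp.lintegral_densityMeasure, ← lintegral_const_mul' _ _ ENNReal.ofReal_ne_top]
  exact lintegral_mono fun x => mul_le_mul_left (ENNReal.ofReal_le_ofReal (hp.le x)) _

theorem memLp_two_densityMeasure {f : E d → ℝ} (hf : MemLp f 2) :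
    MemLp f 2 (densityMeasure p) := by
  have : densityMeasure p ≤ ENNReal.ofReal L • volume := by
    refine Measure.le_iff.2 fun s hs => ?_
    rw [densityMeasure, withDensity_apply _ hs, Measure.smul_apply, smul_eq_mul,
      ← setLIntegral_const]
    exact lintegral_mono fun x => ENNReal.ofReal_le_ofReal (hp.le x)
  exact (hf.smul_measure ENNReal.ofReal_ne_top).mono_measure this

theorem memLp_two : MemLp p 2 := by
  refine (memLp_two_iff_integrable_sq hp.measurable.aestronglyMeasurable).2 ?_
  refine (hp.integrable.const_mul L).mono' (hp.measurable.pow_const 2).aestronglyMeasurable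
    (ae_of_all _ fun x => ?_)
  rw [Real.norm_of_nonneg (sq_nonneg _), sq]
  exact mul_le_mul_of_nonneg_right (hp.le x) (hp.nonneg x)

end IsBoundedDensity

end

section

open scoped FourierTransform
open ProbabilityTheory

/-! ### Mean square error of an empirical mean -/

/-- Squared bias plus variance, the variance being bounded by the second moment. Used with `c = p x`
for the kernel estimators, and with `c` the true mean for the aggregates. -/
theorem lintegral_sq_empirical_mean_sub_le {α : Type*} [MeasurableSpace α] (μ : Measure α)
    [IsProbabilityMeasure μ] {l : ℕ} (hl : 0 < l) {g : α → ℝ} (hg : MemLp g 2 μ) (c : ℝ) :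
    ∫⁻ Y : Fin l → α, ENNReal.ofReal (((l : ℝ)⁻¹ * ∑ i, g (Y i) - c) ^ 2)
        ∂(Measure.pi fun _ => μ) ≤
      ENNReal.ofReal ((∫ x, g x ∂μ - c) ^ 2) +
        ENNReal.ofReal (l : ℝ)⁻¹ * ∫⁻ x, ENNReal.ofReal (g x ^ 2) ∂μ := by
  have hl' : (l : ℝ) ≠ 0 := by positivity
  let g' : α → ℝ := fun y => (l : ℝ)⁻¹ * (g y - c)
  have hg' : MemLp g' 2 μ := (hg.sub (memLp_const c)).const_mul _
  let Z : (Fin l → α) → ℝ := ∑ i, fun Y : Fin l → α => g' (Y i)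
  have hZi : ∀ i : Fin l, MemLp (fun Y : Fin l → α => g' (Y i)) 2 (Measure.pi fun _ => μ) :=
    fun i => hg'.comp_measurePreserving (measurePreserving_eval (fun _ => μ) i)
  have hZ : MemLp Z 2 (Measure.pi fun _ : Fin l => μ) := memLp_finsetSum' _ fun i _ => hZi i
  have hZeq : ∀ Y : Fin l → α, (l : ℝ)⁻¹ * ∑ i, g (Y i) - c = Z Y := by
    intro Y
    simp only [Z, g', Finset.sum_apply, ← Finset.mul_sum, Finset.sum_sub_distrib,
      Finset.sum_const, Finset.card_univ, Fintype.card_fin, nsmul_eq_mul]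
    field_simp
  have hvar : Var[Z; Measure.pi fun _ : Fin l => μ] = (l : ℝ)⁻¹ * Var[g; μ] := by
    have h1 := variance_sum_pi (μ := fun _ : Fin l => μ) (X := fun _ => g') fun _ => hg'
    have h2 : Var[g'; μ] = ((l : ℝ)⁻¹) ^ 2 * Var[g; μ] := by
      rw [variance_const_mul, variance_sub_const hg.1]
    rw [h1]
    simp only [h2, Finset.sum_const, Finset.card_univ, Fintype.card_fin, nsmul_eq_mul]
    field_simp
  have hmean : ∫ Y, Z Y ∂(Measure.pi fun _ : Fin l => μ) = ∫ x, g x ∂μ - c := by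
    simp only [Z, Finset.sum_apply]
    rw [integral_finsetSum _ fun i _ => (hZi i).integrable (by norm_num)]
    have h1 : ∀ i : Fin l, ∫ Y : Fin l → α, g' (Y i) ∂(Measure.pi fun _ : Fin l => μ) =
        ∫ x, g' x ∂μ := fun i => integral_comp_eval (μ := fun _ : Fin l => μ) hg'.1
    simp only [h1, Finset.sum_const, Finset.card_univ, Fintype.card_fin, nsmul_eq_mul, g']
    rw [integral_const_mul, integral_sub (hg.integrable (by norm_num)) (integrable_const _)]
    simp only [integral_const, probReal_univ, one_smul]
    field_simp
  have hsq := variance_eq_sub hZ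
  rw [hvar, hmean] at hsq
  have hv : Var[g; μ] ≤ ∫ x, g x ^ 2 ∂μ := by
    simpa using! variance_le_expectation_sq hg.1
  simp_rw [hZeq]
  rw [← ofReal_integral_eq_lintegral_ofReal hZ.integrable_sq (ae_of_all _ fun _ => sq_nonneg _),
    ← ofReal_integral_eq_lintegral_ofReal hg.integrable_sq (ae_of_all _ fun _ => sq_nonneg _),
    ← ENNReal.ofReal_mul (by positivity), ← ENNReal.ofReal_add (sq_nonneg _)
      (mul_nonneg (by positivity) (integral_nonneg fun _ => sq_nonneg _))]
  refine ENNReal.ofReal_le_ofReal ?_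
  have h3 : ∫ Y, Z Y ^ 2 ∂(Measure.pi fun _ : Fin l => μ) =
      (∫ x, g x ∂μ - c) ^ 2 + (l : ℝ)⁻¹ * Var[g; μ] := by
    simp only [Pi.pow_apply] at hsq
    linarith
  rw [h3]
  gcongr

/-! ### Pinsker kernels in the Fourier domain -/

/-- The Fourier multiplier `(1 - ‖t‖^b)_+` of the Pinsker kernel. -/
def pinskerMultiplier (d : ℕ) (b : ℝ) (t : E d) : ℝ := max (1 - ‖t‖ ^ b) 0

variable {d : ℕ} {b h : ℝ}

theorem continuous_pinskerMultiplier (hb : 0 < b) : Continuous (pinskerMultiplier d b) := by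
  unfold pinskerMultiplier
  exact (continuous_const.sub (continuous_norm.rpow_const fun _ => Or.inr hb.le)).max
    continuous_const

theorem hasCompactSupport_pinskerMultiplier (hb : 0 < b) :
    HasCompactSupport (pinskerMultiplier d b) := by
  refine HasCompactSupport.intro (isCompact_closedBall (0 : E d) 1) fun x hx => ?_
  have : 1 ≤ ‖x‖ := by
    simp only [Metric.mem_closedBall, dist_zero_right, not_le] at hx
    exact hx.le
  unfold pinskerMultiplier
  have := Real.one_le_rpow this hb.le
  exact max_eq_right (by linarith)

theorem pinskerMultiplier_nonneg (t : E d) : 0 ≤ pinskerMultiplier d b t := le_max_right _ _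

theorem pinskerMultiplier_le_one (t : E d) : pinskerMultiplier d b t ≤ 1 :=
  max_le (by have : 0 ≤ ‖t‖ ^ b := by positivity
             linarith) zero_le_one

/-- Inside the unit ball a larger exponent gives a smaller power; outside, the left side is at most
`1`. This is why the smoothness index must be rounded up, never down. -/
theorem one_sub_pinskerMultiplier_le {β : ℝ} (hβ : 0 < β) (hb : β ≤ b) (t : E d) :
    1 - pinskerMultiplier d b t ≤ ‖t‖ ^ β := by
  rcases le_total ‖t‖ 1 with h1 | h1
  · have := Real.rpow_le_rpow_of_exponent_ge' (norm_nonneg t) h1 hβ.le hb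
    have : 1 - ‖t‖ ^ b ≤ pinskerMultiplier d b t := le_max_left _ _
    linarith
  · have := Real.one_le_rpow h1 hβ.le
    have := pinskerMultiplier_nonneg (b := b) t
    linarith

/-- The multiplier of the Pinsker kernel with bandwidth `h`, in the normalization of `𝓕`. -/
def scaledMultiplier (d : ℕ) (b h : ℝ) (ξ : E d) : ℂ :=
  (pinskerMultiplier d b ((2 * Real.pi * h) • ξ) : ℂ)

theorem continuous_scaledMultiplier (hb : 0 < b) : Continuous (scaledMultiplier d b h) := by
  have := continuous_pinskerMultiplier (d := d) hb
  unfold scaledMultiplier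
  fun_prop

theorem hasCompactSupport_scaledMultiplier (hb : 0 < b) (hh : 0 < h) :
    HasCompactSupport (scaledMultiplier d b h) := by
  have h1 := (hasCompactSupport_pinskerMultiplier (d := d) hb).comp_smul
    (c := 2 * Real.pi * h) (by positivity)
  exact h1.comp_left (g := fun x : ℝ => (x : ℂ)) rfl

theorem integrable_scaledMultiplier (hb : 0 < b) (hh : 0 < h) :
    Integrable (scaledMultiplier d b h) :=
  (continuous_scaledMultiplier hb).integrable_of_hasCompactSupport
    (hasCompactSupport_scaledMultiplier hb hh)

/-- The Pinsker kernel with bandwidth `h`. -/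
def scaledKernel (d : ℕ) (b h : ℝ) (z : E d) : ℝ := (h ^ d)⁻¹ * pinskerKernel d b (h⁻¹ • z)

/-- Substitution `t = 2πhξ`, which passes from the convention `e^{i⟨x,t⟩}` to that of `𝓕`. -/
theorem scaledKernel_eq_re_fourier (hh : 0 < h) (z : E d) :
    scaledKernel d b h z = (𝓕 (scaledMultiplier d b h) z).re := by
  have hpi : (0 : ℝ) < 2 * Real.pi := by positivity
  let G : E d → ℂ := fun t => Complex.exp (-(Complex.I * ((inner ℝ t (h⁻¹ • z) : ℝ) : ℂ))) *
      ((max (1 - ‖t‖ ^ b) 0 : ℝ) : ℂ)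
  have h1 : 𝓕 (scaledMultiplier d b h) z = ∫ ξ, G ((2 * Real.pi * h) • ξ) := by
    rw [Real.fourier_eq']
    refine integral_congr_ae (ae_of_all _ fun ξ => ?_)
    simp only [smul_eq_mul, G, scaledMultiplier, pinskerMultiplier, inner_smul_left,
      inner_smul_right]
    congr 2
    simp only [conj_trivial]
    push_cast
    have : (h : ℂ) ≠ 0 := by exact_mod_cast hh.ne'
    field_simp
  rw [h1, Measure.integral_comp_smul, finrank_euclideanSpace_fin, Complex.smul_re, smul_eq_mul,
    abs_of_pos (by positivity), scaledKernel, pinskerKernel, mul_pow, mul_inv]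
  ring

theorem continuous_scaledKernel (hb : 0 < b) (hh : 0 < h) : Continuous (scaledKernel d b h) := by
  have : scaledKernel d b h = fun z => (𝓕 (scaledMultiplier d b h) z).re :=
    funext fun z => scaledKernel_eq_re_fourier hh z
  rw [this]
  exact Complex.continuous_re.comp (continuous_fourier (integrable_scaledMultiplier hb hh))

/-- The integral of the squared multiplier of the Pinsker kernel. -/
def pinskerEnergy (d : ℕ) (b : ℝ) : ℝ := ∫ t : E d, pinskerMultiplier d b t ^ 2

/-- Plancherel is applied to the multiplier, which is continuous with compact support, so
integrability of the kernel itself is never needed. -/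
theorem lintegral_scaledKernel_sq_le (hb : 0 < b) (hh : 0 < h) :
    ∫⁻ z, ENNReal.ofReal (scaledKernel d b h z ^ 2) ≤
      ENNReal.ofReal (((2 * Real.pi) ^ d)⁻¹ * (h ^ d)⁻¹ * pinskerEnergy d b) := by
  have hc := continuous_pinskerMultiplier (d := d) hb
  have hs := hasCompactSupport_pinskerMultiplier (d := d) hb
  have hint : Integrable (fun t : E d => pinskerMultiplier d b t ^ 2) :=
    (hc.memLp_of_hasCompactSupport (p := 2) hs).integrable_sq
  calc ∫⁻ z, ENNReal.ofReal (scaledKernel d b h z ^ 2)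
      ≤ ∫⁻ z, ‖𝓕 (scaledMultiplier d b h) z‖ₑ ^ 2 := by
        refine lintegral_mono fun z => ?_
        rw [scaledKernel_eq_re_fourier hh, ← ofReal_norm, ← ENNReal.ofReal_pow (norm_nonneg _),
          ← sq_abs]
        exact ENNReal.ofReal_le_ofReal (pow_le_pow_left₀ (abs_nonneg _)
          (Complex.abs_re_le_norm _) 2)
    _ = ∫⁻ ξ, ‖scaledMultiplier d b h ξ‖ₑ ^ 2 :=
        lintegral_enorm_fourier_sq (integrable_scaledMultiplier hb hh)
          ((continuous_scaledMultiplier hb).memLp_of_hasCompactSupport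
            (hasCompactSupport_scaledMultiplier hb hh))
    _ = ∫⁻ ξ, (fun t => ENNReal.ofReal (pinskerMultiplier d b t ^ 2))
          ((2 * Real.pi * h) • ξ) := by
        refine lintegral_congr fun ξ => ?_
        rw [scaledMultiplier, ← ofReal_norm, Complex.norm_real, Real.norm_eq_abs,
          ← ENNReal.ofReal_pow (abs_nonneg _), sq_abs]
    _ = _ := by
        rw [lintegral_comp_smul (fun t : E d => ENNReal.ofReal (pinskerMultiplier d b t ^ 2))
          (by positivity),
          ← ofReal_integral_eq_lintegral_ofReal hint (ae_of_all _ fun _ => sq_nonneg _),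
          ← ENNReal.ofReal_mul (abs_nonneg _), abs_of_pos (by positivity), mul_pow, mul_inv]
        rfl

theorem memLp_scaledKernel (hb : 0 < b) (hh : 0 < h) : MemLp (scaledKernel d b h) 2 := by
  have hc := continuous_scaledKernel (d := d) hb hh
  refine (memLp_two_iff_integrable_sq hc.aestronglyMeasurable).2
    ⟨(hc.pow 2).aestronglyMeasurable, ?_⟩
  rw [hasFiniteIntegral_iff_ofReal (ae_of_all _ fun _ => sq_nonneg _)]
  exact (lintegral_scaledKernel_sq_le hb hh).trans_lt ENNReal.ofReal_lt_top

theorem kernelEstimator_eq {m : ℕ} (Y : Fin m → E d) (x : E d) :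
    kernelEstimator (pinskerKernel d b) h Y x =
      (m : ℝ)⁻¹ * ∑ i, scaledKernel d b h (Y i - x) := by
  simp only [kernelEstimator, scaledKernel, ← Finset.mul_sum, mul_inv, mul_assoc]

end

section

open scoped FourierTransform
open ProbabilityTheory

variable {d : ℕ} {b h β Q L : ℝ} {p : E d → ℝ}

/-! ### The risk of the Pinsker kernel estimator -/

theorem fourier_comp_sub {f : E d → ℂ} (x y : E d) :
    𝓕 f (y - x) =
      𝓕 (fun ξ => Complex.exp (↑(2 * Real.pi * inner ℝ ξ x) * Complex.I) * f ξ) y := by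
  rw [Real.fourier_eq', Real.fourier_eq']
  refine integral_congr_ae (ae_of_all _ fun ξ => ?_)
  simp only [smul_eq_mul, inner_sub_right]
  rw [← mul_assoc, ← Complex.exp_add]
  congr 2
  push_cast
  ring

/-- The convolution theorem. The translated kernel is the real part of the transform of a modulated
multiplier, and that transform is moved onto `p`. -/
theorem integral_mul_scaledKernel (hb : 0 < b) (hh : 0 < h) (hp : Integrable p) (x : E d) :
    ∫ y, p y * scaledKernel d b h (y - x) =
      (𝓕⁻ (fun ξ => scaledMultiplier d b h ξ * 𝓕 (fun x => (p x : ℂ)) ξ) x).re := by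
  have hk := integrable_scaledMultiplier (d := d) hb hh
  let e : E d → ℂ := fun ξ => Complex.exp (↑(2 * Real.pi * inner ℝ ξ x) * Complex.I)
  have he : Continuous e := by
    simp only [e]
    fun_prop
  have hek : Integrable (fun ξ => e ξ * scaledMultiplier d b h ξ) := by
    refine hk.bdd_mul (c := 1) he.aestronglyMeasurable (ae_of_all _ fun ξ => ?_)
    simp only [e, Complex.norm_exp_ofReal_mul_I, le_refl]
  have h1 := integral_fourier_mul (f := fun x => (p x : ℂ)) hp.ofReal hek
  have h2 : ∀ y, (𝓕 (fun ξ => e ξ * scaledMultiplier d b h ξ)) y =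
      𝓕 (scaledMultiplier d b h) (y - x) := fun y => (fourier_comp_sub x y).symm
  simp_rw [h2] at h1
  have h3 : Integrable (fun y => (p y : ℂ) * 𝓕 (scaledMultiplier d b h) (y - x)) := by
    refine hp.ofReal.mul_bdd (c := ∫ ξ, ‖scaledMultiplier d b h ξ‖)
      ((continuous_fourier hk).comp (continuous_id.sub continuous_const)).aestronglyMeasurable
      (ae_of_all _ fun ξ => norm_fourier_le_integral_norm _ _)
  have h4 : ∫ y, p y * scaledKernel d b h (y - x) =
      (∫ y, (p y : ℂ) * 𝓕 (scaledMultiplier d b h) (y - x)).re := by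
    rw [← RCLike.re_eq_complex_re, ← integral_re h3]
    refine integral_congr_ae (ae_of_all _ fun y => ?_)
    simp only [RCLike.re_eq_complex_re, Complex.re_ofReal_mul, scaledKernel_eq_re_fourier hh]
  rw [h4]
  congr 1
  refine Eq.trans h1.symm ?_
  rw [Real.fourierInv_eq']
  refine integral_congr_ae (ae_of_all _ fun ξ => ?_)
  simp only [smul_eq_mul, e]
  ring

/-- Fourier inversion, available since `β > d/2`, shows that the bias is almost everywhere the real
part of the inverse transform of `(k - 1) 𝓕 p`. Plancherel and `‖k ξ - 1‖ ≤ (2πh‖ξ‖)^β` then leave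
the Sobolev integral. -/
theorem lintegral_bias_sq_le (hβ : (d : ℝ) / 2 < β) (hQ : 0 < Q) (hb : β ≤ b) (hh : 0 < h)
    (hp : p ∈ sobolevClass d β Q) :
    ∫⁻ x, ENNReal.ofReal (((∫ y, p y * scaledKernel d b h (y - x)) - p x) ^ 2) ≤
      ENNReal.ofReal (((2 * Real.pi) ^ d)⁻¹ * (h ^ (2 * β) * Q)) := by
  have hβ0 : 0 < β := lt_of_le_of_lt (by positivity) hβ
  have hb0 : 0 < b := hβ0.trans_le hb
  have hpi : (0 : ℝ) < 2 * Real.pi := by positivity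
  have hpint := integrable_of_mem_sobolevClass hp
  have hF := integrable_fourier_of_mem_sobolevClass hβ hQ hp
  set F := 𝓕 (fun x => (p x : ℂ)) with hFdef
  let k := scaledMultiplier d b h
  have hkc : Continuous k := continuous_scaledMultiplier hb0
  have hk1 : ∀ ξ, ‖k ξ - 1‖ = 1 - pinskerMultiplier d b ((2 * Real.pi * h) • ξ) := by
    intro ξ
    have : k ξ - 1 = -((1 - pinskerMultiplier d b ((2 * Real.pi * h) • ξ) : ℝ) : ℂ) := by
      simp only [k, scaledMultiplier]
      push_cast
      ring
    rw [this, norm_neg, Complex.norm_real, Real.norm_of_nonneg]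
    linarith [pinskerMultiplier_le_one (b := b) ((2 * Real.pi * h) • ξ)]
  have hk1' : ∀ ξ, ‖k ξ - 1‖ ≤ 1 := fun ξ => by
    rw [hk1]; linarith [pinskerMultiplier_nonneg (b := b) ((2 * Real.pi * h) • ξ)]
  have hkn : ∀ ξ, ‖k ξ‖ ≤ 1 := fun ξ => by
    simp only [k, scaledMultiplier]
    rw [Complex.norm_real, Real.norm_of_nonneg (pinskerMultiplier_nonneg _)]
    exact pinskerMultiplier_le_one _
  let g : E d → ℂ := fun ξ => (k ξ - 1) * F ξ
  have hkF : Integrable fun ξ => k ξ * F ξ :=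
    hF.bdd_mul (c := 1) hkc.aestronglyMeasurable (ae_of_all _ hkn)
  have hg : Integrable g :=
    hF.bdd_mul (c := 1) (hkc.sub continuous_const).aestronglyMeasurable (ae_of_all _ hk1')
  have hg1 : ∀ ξ, ‖g ξ‖ ≤ 1 := fun ξ => by
    simp only [g, norm_mul]
    exact mul_le_one₀ (hk1' ξ) (norm_nonneg _) (norm_fourier_le_one_of_mem_sobolevClass hp ξ)
  -- An integrable function bounded by `1` is square integrable.
  have hg2 : MemLp g 2 := by
    refine (memLp_two_iff_integrable_sq_norm hg.aestronglyMeasurable).2 ?_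
    refine hg.norm.mono' (hg.aestronglyMeasurable.norm.pow 2) (ae_of_all _ fun ξ => ?_)
    rw [Real.norm_of_nonneg (sq_nonneg _), sq]
    exact mul_le_of_le_one_left (norm_nonneg _) (hg1 ξ)
  have hae : ∀ᵐ x, ENNReal.ofReal (((∫ y, p y * scaledKernel d b h (y - x)) - p x) ^ 2) ≤
      ‖𝓕 g (-x)‖ₑ ^ 2 := by
    filter_upwards [fourierInv_fourier_ae_eq hpint.ofReal hF] with x hx
    have h1 : 𝓕 g (-x) = 𝓕⁻ (fun ξ => k ξ * F ξ) x - (p x : ℂ) := by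
      rw [← Real.fourierInv_eq_fourier_neg]
      have hx' : 𝓕⁻ F x = (p x : ℂ) := hx
      rw [← hx']
      rw [Real.fourierInv_eq, Real.fourierInv_eq, Real.fourierInv_eq, ← integral_sub]
      · refine integral_congr_ae (ae_of_all _ fun ξ => ?_)
        simp only [g, sub_mul, one_mul, smul_sub]
      · have := (Real.fourierIntegral_convergent_iff (-x)).2 hkF
        simpa using this
      · have := (Real.fourierIntegral_convergent_iff (-x)).2 hF
        simpa using this
    rw [integral_mul_scaledKernel hb0 hh hpint, ← ofReal_norm, ← ENNReal.ofReal_pow (norm_nonneg _),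
      h1, ← sq_abs]
    refine ENNReal.ofReal_le_ofReal (pow_le_pow_left₀ (abs_nonneg _) ?_ 2)
    refine le_trans (le_of_eq ?_) (Complex.abs_re_le_norm _)
    simp [k, hFdef]
  refine (lintegral_mono_ae hae).trans ?_
  rw [lintegral_neg_eq_self (fun x => ‖𝓕 g x‖ₑ ^ 2), lintegral_enorm_fourier_sq hg hg2]
  have h2 : ∀ ξ, ‖g ξ‖ₑ ^ 2 ≤ ENNReal.ofReal ((2 * Real.pi * h) ^ (2 * β)) *
      ENNReal.ofReal (‖ξ‖ ^ (2 * β) * ‖F ξ‖ ^ 2) := by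
    intro ξ
    rw [← ENNReal.ofReal_mul (by positivity), ← ofReal_norm, ← ENNReal.ofReal_pow (norm_nonneg _)]
    refine ENNReal.ofReal_le_ofReal ?_
    have h3 : ‖k ξ - 1‖ ≤ (2 * Real.pi * h) ^ β * ‖ξ‖ ^ β := by
      rw [hk1]
      refine (one_sub_pinskerMultiplier_le hβ0 hb _).trans (le_of_eq ?_)
      rw [norm_smul, Real.norm_of_nonneg (by positivity), Real.mul_rpow (by positivity)
        (norm_nonneg _)]
    have h4 : ∀ r : ℝ, 0 ≤ r → r ^ (2 * β) = (r ^ β) ^ 2 := fun r hr => by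
      rw [← Real.rpow_natCast, ← Real.rpow_mul hr]; congr 1; push_cast; ring
    rw [show ‖g ξ‖ = ‖k ξ - 1‖ * ‖F ξ‖ from norm_mul _ _, mul_pow, h4 _ (by positivity),
      h4 _ (norm_nonneg _), ← mul_assoc, ← mul_pow _ (‖ξ‖ ^ β)]
    exact mul_le_mul_of_nonneg_right (pow_le_pow_left₀ (norm_nonneg _) h3 2) (sq_nonneg _)
  refine (lintegral_mono h2).trans ?_
  rw [lintegral_const_mul' _ _ ENNReal.ofReal_ne_top]
  refine (mul_le_mul_right (lintegral_rpow_mul_fourier_sq_le hp) _).trans (le_of_eq ?_)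
  rw [← ENNReal.ofReal_mul (by positivity), Real.mul_rpow hpi.le hh.le]
  congr 1
  field_simp

/-- The risk bound of the Pinsker kernel estimator. -/
def kernelRiskBound (d : ℕ) (β Q b h : ℝ) (m : ℕ) : ℝ :=
  ((2 * Real.pi) ^ d)⁻¹ * (h ^ (2 * β) * Q + (m : ℝ)⁻¹ * (h ^ d)⁻¹ * pinskerEnergy d b)

theorem pinskerEnergy_nonneg : 0 ≤ pinskerEnergy d b := integral_nonneg fun _ => sq_nonneg _

theorem measurable_kernelEstimator {m : ℕ} (hb : 0 < b) (hh : 0 < h) :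
    Measurable fun z : (Fin m → E d) × E d => kernelEstimator (pinskerKernel d b) h z.1 z.2 := by
  have hc := continuous_scaledKernel (d := d) hb hh
  simp_rw [kernelEstimator_eq]
  refine Continuous.measurable ?_
  fun_prop

theorem risk_kernelEstimator_le (hβ : (d : ℝ) / 2 < β) (hQ : 0 < Q) (hb : β ≤ b) (hh : 0 < h)
    {m : ℕ} (hm : 0 < m) (hp : p ∈ sobolevClass d β Q) (hpL : IsBoundedDensity p L) :
    risk (kernelEstimator (m := m) (pinskerKernel d b) h) p ≤
      ENNReal.ofReal (kernelRiskBound d β Q b h m) := by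
  have hβ0 : 0 < β := lt_of_le_of_lt (by positivity) hβ
  have hb0 : 0 < b := hβ0.trans_le hb
  have := hpL.isProbabilityMeasure
  have hK := continuous_scaledKernel (d := d) hb0 hh
  have hK2 := memLp_scaledKernel (d := d) hb0 hh
  change ∫⁻ X : Fin m → E d, (∫⁻ x : E d, ENNReal.ofReal
    ((kernelEstimator (pinskerKernel d b) h X x - p x) ^ 2))
      ∂(Measure.pi fun _ => densityMeasure p) ≤ _
  have hmeas : Measurable (fun z : (Fin m → E d) × E d => ENNReal.ofReal
      ((kernelEstimator (pinskerKernel d b) h z.1 z.2 - p z.2) ^ 2)) :=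
    (((measurable_kernelEstimator hb0 hh).sub
      (hpL.measurable.comp measurable_snd)).pow_const 2).ennreal_ofReal
  rw [lintegral_lintegral_swap hmeas.aemeasurable]
  have h1 : ∀ x : E d, ∫⁻ X : Fin m → E d, ENNReal.ofReal
      ((kernelEstimator (pinskerKernel d b) h X x - p x) ^ 2)
        ∂(Measure.pi fun _ => densityMeasure p) ≤
      ENNReal.ofReal (((∫ y, p y * scaledKernel d b h (y - x)) - p x) ^ 2) +
        ENNReal.ofReal (m : ℝ)⁻¹ *
          ∫⁻ y, ENNReal.ofReal (scaledKernel d b h (y - x) ^ 2) ∂densityMeasure p := by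
    intro x
    have h2 := lintegral_sq_empirical_mean_sub_le (densityMeasure p) hm
      (hpL.memLp_two_densityMeasure
        (hK2.comp_measurePreserving (measurePreserving_sub_right volume x))) (p x)
    rw [hpL.integral_densityMeasure] at h2
    simpa only [kernelEstimator_eq, Function.comp_apply] using h2
  refine (lintegral_mono h1).trans ?_
  have hmeas2 : Measurable fun z : E d × E d =>
      ENNReal.ofReal (scaledKernel d b h (z.2 - z.1) ^ 2) := by
    refine Measurable.ennreal_ofReal (Continuous.measurable ?_)
    fun_prop
  rw [lintegral_add_right _ (hmeas2.lintegral_prod_right'.const_mul _),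
    lintegral_const_mul' _ _ ENNReal.ofReal_ne_top,
    lintegral_lintegral_swap hmeas2.aemeasurable]
  -- Integrating in `x` first makes the second moment independent of `y`, so only the total mass of
  -- `p` enters the variance, not its bound `L`.
  have h3 : ∀ y : E d, ∫⁻ x, ENNReal.ofReal (scaledKernel d b h (y - x) ^ 2) =
      ∫⁻ z, ENNReal.ofReal (scaledKernel d b h z ^ 2) := fun y =>
    lintegral_sub_left_eq_self (fun z => ENNReal.ofReal (scaledKernel d b h z ^ 2)) y
  simp_rw [h3]
  rw [lintegral_const, measure_univ, mul_one]
  refine (add_le_add (lintegral_bias_sq_le hβ hQ hb hh hp)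
    (mul_le_mul_right (lintegral_scaledKernel_sq_le hb0 hh) _)).trans (le_of_eq ?_)
  have hE := pinskerEnergy_nonneg (d := d) (b := b)
  rw [← ENNReal.ofReal_mul (by positivity), ← ENNReal.ofReal_add (by positivity) (by positivity)]
  congr 1
  unfold kernelRiskBound
  ring

end

section

variable {d : ℕ} {L : ℝ} {p : E d → ℝ} {ι : Type} [Fintype ι] {l : ℕ}

/-! ### The stochastic term of an aggregate -/

/-- The excess `2 (ℓ⁻¹ ∑ u(Y_i) - ∫ u p) - ‖u‖²` of the direction `u`. -/
def empiricalExcess (p : E d → ℝ) (Y : Fin l → E d) (u : E d → ℝ) : ℝ :=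
  2 * ((l : ℝ)⁻¹ * ∑ i, u (Y i) - ∫ x, u x * p x) - ∫ x, u x ^ 2

theorem integral_sum_smul_mul {κ : Type*} [Fintype κ] {v : κ → E d → ℝ} (hv : ∀ k, MemLp (v k) 2)
    {g : E d → ℝ} (hg : MemLp g 2) (c : κ → ℝ) :
    ∫ x, (∑ k, c k • v k) x * g x = ∑ k, c k * ∫ x, v k x * g x := by
  have hint : ∀ k, Integrable fun x => c k * (v k x * g x) := fun k =>
    ((hv k).integrable_mul hg).const_mul (c k)
  simp_rw [← integral_const_mul]
  rw [← integral_finsetSum _ fun k _ => hint k]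
  refine integral_congr_ae (ae_of_all _ fun x => ?_)
  simp only [Finset.sum_apply, Pi.smul_apply, smul_eq_mul, Finset.sum_mul, mul_assoc]

/-- This explicit quadratic polynomial in the coefficients yields continuity in `c`, measurability
in the samples, and diagonalization in an orthonormal basis. -/
theorem empiricalExcess_sum_smul {κ : Type*} [Fintype κ] {v : κ → E d → ℝ}
    (hv : ∀ k, MemLp (v k) 2) (hp : MemLp p 2) (Y : Fin l → E d) (c : κ → ℝ) :
    empiricalExcess p Y (∑ k, c k • v k) =
      2 * ∑ k, c k * ((l : ℝ)⁻¹ * ∑ i, v k (Y i) - ∫ x, v k x * p x) -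
        ∑ k, c k * ∑ k', c k' * ∫ x, v k' x * v k x := by
  have hu : MemLp (∑ k, c k • v k) 2 := memLp_finsetSum' _ fun k _ => (hv k).const_smul (c k)
  have h1 : ∫ x, (∑ k, c k • v k) x ^ 2 = ∑ k, c k * ∑ k', c k' * ∫ x, v k' x * v k x := by
    simp_rw [sq]
    rw [integral_sum_smul_mul hv hu]
    refine Finset.sum_congr rfl fun k _ => ?_
    rw [← integral_sum_smul_mul hv (hv k)]
    simp_rw [mul_comm]
  rw [empiricalExcess, h1, integral_sum_smul_mul hv hp]
  congr 2
  simp only [Finset.sum_apply, Pi.smul_apply, smul_eq_mul, mul_sub, Finset.sum_sub_distrib]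
  congr 1
  rw [Finset.sum_comm, Finset.mul_sum]
  refine Finset.sum_congr rfl fun k _ => ?_
  rw [← Finset.mul_sum]
  ring

/-- The supremum of the excess over the (rational) linear combinations of the `q_j`. -/
def excessSup (p : E d → ℝ) (q : ι → E d → ℝ) (Y : Fin l → E d) : ENNReal :=
  ⨆ w : ι → ℚ, ENNReal.ofReal (empiricalExcess p Y (∑ j, (w j : ℝ) • q j))

/-- Rational coefficients keep the supremum countable, hence measurable; by continuity and density
they lose nothing. -/
theorem empiricalExcess_le_excessSup {q : ι → E d → ℝ} (hq : ∀ j, MemLp (q j) 2)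
    (hp : MemLp p 2) (Y : Fin l → E d) {u : E d → ℝ} (hu : u ∈ Submodule.span ℝ (Set.range q)) :
    ENNReal.ofReal (empiricalExcess p Y u) ≤ excessSup p q Y := by
  obtain ⟨c, rfl⟩ := (Submodule.mem_span_range_iff_exists_fun ℝ).1 hu
  have hcont : Continuous fun c : ι → ℝ =>
      ENNReal.ofReal (empiricalExcess p Y (∑ j, c j • q j)) := by
    simp_rw [empiricalExcess_sum_smul hq hp]
    refine ENNReal.continuous_ofReal.comp ?_
    fun_prop
  have hclosed : IsClosed {c : ι → ℝ |
      ENNReal.ofReal (empiricalExcess p Y (∑ j, c j • q j)) ≤ excessSup p q Y} :=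
    isClosed_le hcont continuous_const
  have hdense : DenseRange fun (w : ι → ℚ) (j : ι) => (w j : ℝ) :=
    DenseRange.piMap fun _ => Rat.denseRange_cast
  refine hdense.induction_on (p := fun c : ι → ℝ =>
    ENNReal.ofReal (empiricalExcess p Y (∑ j, c j • q j)) ≤ excessSup p q Y) c hclosed fun w => ?_
  exact le_iSup (fun w : ι → ℚ => ENNReal.ofReal
    (empiricalExcess p Y (∑ j, (w j : ℝ) • q j))) w

theorem measurable_excessSup {Ω : Type*} [MeasurableSpace Ω] {q : ι → Ω → E d → ℝ}
    (hqm : ∀ j, Measurable fun z : Ω × E d => q j z.1 z.2) (hq : ∀ j T, MemLp (q j T) 2)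
    (hp : MemLp p 2) (hpm : Measurable p) :
    Measurable fun z : Ω × (Fin l → E d) => excessSup p (fun j => q j z.1) z.2 := by
  unfold excessSup
  refine Measurable.iSup fun w => Measurable.ennreal_ofReal ?_
  simp_rw [empiricalExcess_sum_smul (fun j => hq j _) hp]
  have h1 : ∀ j, Measurable fun z : Ω × (Fin l → E d) => ∫ x, q j z.1 x * p x := fun j => by
    have : Measurable fun z : Ω × E d => q j z.1 z.2 * p z.2 :=
      (hqm j).mul (hpm.comp measurable_snd)
    exact (this.stronglyMeasurable.integral_prod_right' (ν := volume)).measurable.comp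
      measurable_fst
  have h2 : ∀ j k, Measurable fun z : Ω × (Fin l → E d) => ∫ x, q j z.1 x * q k z.1 x :=
    fun j k => by
      have : Measurable fun z : Ω × E d => q j z.1 z.2 * q k z.1 z.2 := (hqm j).mul (hqm k)
      exact (this.stronglyMeasurable.integral_prod_right' (ν := volume)).measurable.comp
        measurable_fst
  have h3 : ∀ j i, Measurable fun z : Ω × (Fin l → E d) => q j z.1 (z.2 i) := fun j i =>
    (hqm j).comp (measurable_fst.prodMk ((measurable_pi_apply i).comp measurable_snd))
  fun_prop

omit [Fintype ι] in
theorem continuous_of_mem_span {q : ι → E d → ℝ} (hc : ∀ j, Continuous (q j)) {u : E d → ℝ}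
    (hu : u ∈ Submodule.span ℝ (Set.range q)) : Continuous u := by
  refine Submodule.span_induction (p := fun u _ => Continuous u) ?_ continuous_zero
    (fun u v _ _ hu hv => hu.add hv) (fun c u _ hu => hu.const_smul c) hu
  rintro _ ⟨j, rfl⟩
  exact hc j

omit [Fintype ι] in
/-- An orthonormal basis of the span of continuous functions spans them pointwise. -/
theorem IsOrthonormalBasisOfSpan.span_le {q : ι → E d → ℝ} (hc : ∀ j, Continuous (q j)) {r : ℕ}
    {φ : Fin r → E d → ℝ} (h : IsOrthonormalBasisOfSpan q φ) :
    Submodule.span ℝ (Set.range q) ≤ Submodule.span ℝ (Set.range φ) := by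
  rw [Submodule.span_le]
  rintro _ ⟨j, rfl⟩
  obtain ⟨g, hg, hjg⟩ := h.spans j
  have h1 : Submodule.span ℝ (Set.range φ) ≤ Submodule.span ℝ (Set.range q) := by
    rw [Submodule.span_le]
    rintro _ ⟨k, rfl⟩
    exact h.mem_span k
  have : q j = g := ((hc j).ae_eq_iff_eq volume (continuous_of_mem_span hc (h1 hg))).1 hjg
  rw [this]
  exact hg

theorem memLp_of_mem_span {q : ι → E d → ℝ} (hq : ∀ j, MemLp (q j) 2) {u : E d → ℝ}
    (hu : u ∈ Submodule.span ℝ (Set.range q)) : MemLp u 2 := by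
  obtain ⟨c, rfl⟩ := (Submodule.mem_span_range_iff_exists_fun ℝ).1 hu
  exact memLp_finsetSum' _ fun j _ => (hq j).const_smul (c j)

theorem IsOrthonormalBasisOfSpan.length_le {q : ι → E d → ℝ} (hq : ∀ j, MemLp (q j) 2) {r : ℕ}
    {φ : Fin r → E d → ℝ} (h : IsOrthonormalBasisOfSpan q φ) : r ≤ Fintype.card ι := by
  have hφ : ∀ k, MemLp (φ k) 2 := fun k => memLp_of_mem_span hq (h.mem_span k)
  have hli : LinearIndependent ℝ φ := by
    rw [Fintype.linearIndependent_iff]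
    intro c hc k
    have h1 := integral_sum_smul_mul hφ (hφ k) c
    rw [hc] at h1
    simpa [h.orthonormal] using h1.symm
  have hfin : Module.Finite ℝ (Submodule.span ℝ (Set.range q)) :=
    FiniteDimensional.span_of_finite ℝ (Set.finite_range q)
  have h2 := finrank_span_eq_card hli
  rw [Fintype.card_fin] at h2
  rw [← h2]
  refine le_trans (Submodule.finrank_mono ?_) (finrank_range_le_card q)
  rw [Submodule.span_le]
  rintro _ ⟨k, rfl⟩
  exact h.mem_span k

/-- In orthonormal coordinates the excess is `∑ (2 c_k ξ_k - c_k²) ≤ ∑ ξ_k²`, with `ξ_k` the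
centered empirical mean of `φ_k`. Each `ξ_k²` has expectation at most `L/ℓ`, and there are at most
`card ι` of them. -/
theorem lintegral_excessSup_le (hp : IsBoundedDensity p L) (hl : 0 < l) {q : ι → E d → ℝ}
    (hc : ∀ j, Continuous (q j)) (hq : ∀ j, MemLp (q j) 2) :
    ∫⁻ Y : Fin l → E d, excessSup p q Y ∂(Measure.pi fun _ => densityMeasure p) ≤
      ENNReal.ofReal (L * Fintype.card ι / l) := by
  obtain ⟨⟨r, φ⟩, hφ⟩ := exists_isOrthonormalBasisOfSpan q hq
  dsimp only at hφ
  have := hp.isProbabilityMeasure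
  have hφ2 : ∀ k, MemLp (φ k) 2 := fun k => memLp_of_mem_span hq (hφ.mem_span k)
  let ξ : Fin r → (Fin l → E d) → ℝ := fun k Y =>
    (l : ℝ)⁻¹ * ∑ i, φ k (Y i) - ∫ x, φ k x ∂densityMeasure p
  have hξm : ∀ k, AEMeasurable (ξ k) (Measure.pi fun _ => densityMeasure p) := fun k => by
    have : ∀ i : Fin l, AEMeasurable (fun Y : Fin l → E d => φ k (Y i))
        (Measure.pi fun _ => densityMeasure p) := fun i =>
      ((hp.memLp_two_densityMeasure (hφ2 k)).comp_measurePreserving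
        (measurePreserving_eval (fun _ => densityMeasure p) i)).1.aemeasurable
    exact ((Finset.aemeasurable_fun_sum _ fun i _ => this i).const_mul _).sub_const _
  have h1 : ∀ Y, excessSup p q Y ≤ ∑ k, ENNReal.ofReal (ξ k Y ^ 2) := by
    intro Y
    refine iSup_le fun w => ?_
    have hw : ∑ j, (w j : ℝ) • q j ∈ Submodule.span ℝ (Set.range φ) :=
      hφ.span_le hc (Submodule.sum_mem _ fun j _ => Submodule.smul_mem _ _
        (Submodule.subset_span ⟨j, rfl⟩))
    obtain ⟨c, hcw⟩ := (Submodule.mem_span_range_iff_exists_fun ℝ).1 hw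
    rw [← hcw, empiricalExcess_sum_smul hφ2 hp.memLp_two,
      ← ENNReal.ofReal_sum_of_nonneg fun k _ => sq_nonneg _]
    refine ENNReal.ofReal_le_ofReal ?_
    rw [Finset.mul_sum, ← Finset.sum_sub_distrib]
    refine Finset.sum_le_sum fun k _ => ?_
    have h2 : ∫ x, φ k x * p x = ∫ x, φ k x ∂densityMeasure p := by
      rw [hp.integral_densityMeasure]
      simp_rw [mul_comm]
    simp only [hφ.orthonormal, mul_ite, mul_one, mul_zero, Finset.sum_ite_eq', Finset.mem_univ,
      if_true, h2]
    change 2 * (c k * ξ k Y) - _ ≤ _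
    nlinarith [sq_nonneg (c k - ξ k Y)]
  refine (lintegral_mono h1).trans ?_
  rw [lintegral_finsetSum' _ fun k _ => ((hξm k).pow_const 2).ennreal_ofReal]
  have h3 : ∀ k, ∫⁻ Y, ENNReal.ofReal (ξ k Y ^ 2) ∂(Measure.pi fun _ => densityMeasure p) ≤
      ENNReal.ofReal ((l : ℝ)⁻¹ * L) := by
    intro k
    refine (lintegral_sq_empirical_mean_sub_le (densityMeasure p) hl
      (hp.memLp_two_densityMeasure (hφ2 k)) _).trans ?_
    rw [sub_self, zero_pow two_ne_zero, ENNReal.ofReal_zero, zero_add,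
      ENNReal.ofReal_mul (by positivity)]
    refine mul_le_mul_right ((hp.lintegral_densityMeasure_le _).trans (le_of_eq ?_)) _
    rw [← ofReal_integral_eq_lintegral_ofReal (hφ2 k).integrable_sq
      (ae_of_all _ fun _ => sq_nonneg _)]
    have := hφ.orthonormal k k
    simp only [← sq, if_true] at this
    rw [this, ENNReal.ofReal_one, mul_one]
  refine (Finset.sum_le_sum fun k _ => h3 k).trans ?_
  rw [Finset.sum_const, Finset.card_univ, Fintype.card_fin, nsmul_eq_mul,
    ← ENNReal.ofReal_natCast, ← ENNReal.ofReal_mul (by positivity)]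
  refine ENNReal.ofReal_le_ofReal ?_
  have h4 : (r : ℝ) ≤ Fintype.card ι := by exact_mod_cast hφ.length_le hq
  have := hp.bound_nonneg
  rw [div_eq_mul_inv, mul_comm (l : ℝ)⁻¹, ← mul_assoc, mul_comm L]
  gcongr

/-! ### Oracle inequalities -/

/-- With `u = g - q_j`, `‖g - p‖² = ‖q_j - p‖² + 2⟨g, u⟩ - 2⟨u, p⟩ - ‖u‖²`. The hypothesis trades
`⟨g, u⟩` for an empirical mean, and what remains is the excess of `u`. It is the only property of an
aggregate that the oracle inequality needs. -/
theorem lintegral_sq_sub_le_add_excessSup (hp : MemLp p 2) {q : ι → E d → ℝ}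
    (hq : ∀ j, MemLp (q j) 2) (Y : Fin l → E d) {g : E d → ℝ}
    (hg : g ∈ Submodule.span ℝ (Set.range q)) (j : ι)
    (h : ∫ x, g x * (g x - q j x) ≤ (l : ℝ)⁻¹ * ∑ i, (g (Y i) - q j (Y i))) :
    ∫⁻ x, ENNReal.ofReal ((g x - p x) ^ 2) ≤
      (∫⁻ x, ENNReal.ofReal ((q j x - p x) ^ 2)) + excessSup p q Y := by
  have hg2 := memLp_of_mem_span hq hg
  have hu : g - q j ∈ Submodule.span ℝ (Set.range q) :=
    Submodule.sub_mem _ hg (Submodule.subset_span ⟨j, rfl⟩)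
  have hu2 : MemLp (g - q j) 2 := memLp_of_mem_span hq hu
  refine le_trans ?_ (add_le_add_right (empiricalExcess_le_excessSup hq hp Y hu) _)
  have hgp : Integrable (fun x => (g x - p x) ^ 2) := (hg2.sub hp).integrable_sq
  have hqp : Integrable (fun x => (q j x - p x) ^ 2) := ((hq j).sub hp).integrable_sq
  rw [← ofReal_integral_eq_lintegral_ofReal hgp (ae_of_all _ fun _ => sq_nonneg _),
    ← ofReal_integral_eq_lintegral_ofReal hqp (ae_of_all _ fun _ => sq_nonneg _)]
  refine (ENNReal.ofReal_le_ofReal ?_).trans ENNReal.ofReal_add_le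
  have h1 : Integrable fun x => g x * (g - q j) x := hg2.integrable_mul hu2
  have h2 : Integrable fun x => (g - q j) x * p x := hu2.integrable_mul hp
  have h3 : Integrable fun x => (g - q j) x ^ 2 := hu2.integrable_sq
  have h4 : ∫ x, (g x - p x) ^ 2 = (∫ x, (q j x - p x) ^ 2) + 2 * (∫ x, g x * (g - q j) x)
      - 2 * (∫ x, (g - q j) x * p x) - ∫ x, (g - q j) x ^ 2 := by
    have i1 : Integrable fun x => (q j x - p x) ^ 2 + 2 * (g x * (g - q j) x) :=
      hqp.add (h1.const_mul 2)
    have i2 : Integrable fun x => (q j x - p x) ^ 2 + 2 * (g x * (g - q j) x) -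
      2 * ((g - q j) x * p x) := i1.sub (h2.const_mul 2)
    rw [← integral_const_mul, ← integral_const_mul, ← integral_add hqp (h1.const_mul 2),
      ← integral_sub i1 (h2.const_mul 2), ← integral_sub i2 h3]
    refine integral_congr_ae (ae_of_all _ fun x => ?_)
    simp only [Pi.sub_apply]
    ring
  rw [h4, empiricalExcess]
  simp only [Pi.sub_apply] at h ⊢
  linarith

theorem linearAggregate_mem_span {q : ι → E d → ℝ} (hq : ∀ j, MemLp (q j) 2)
    (Y : Fin l → E d) : linearAggregate q Y ∈ Submodule.span ℝ (Set.range q) := by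
  have hφ : IsOrthonormalBasisOfSpan q (spanBasis q).2 :=
    Classical.epsilon_spec (exists_isOrthonormalBasisOfSpan q hq)
  have : linearAggregate q Y = ∑ k, ((l : ℝ)⁻¹ * ∑ i, (spanBasis q).2 k (Y i)) •
      (spanBasis q).2 k := by
    funext x
    simp [linearAggregate]
  rw [this]
  exact Submodule.sum_mem _ fun k _ => Submodule.smul_mem _ _ (hφ.mem_span k)

/-- The coefficients of the aggregate are the empirical means of the `φ_k`, so `⟨g, u⟩` equals the
empirical mean of `u` for `u` in the span. Continuity of the `q_j` makes their expansions in the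
`φ_k` valid at the observations, not just almost everywhere. -/
theorem lintegral_linearAggregate_sub_sq_le (hp : MemLp p 2) {q : ι → E d → ℝ}
    (hc : ∀ j, Continuous (q j)) (hq : ∀ j, MemLp (q j) 2) (Y : Fin l → E d) (j : ι) :
    ∫⁻ x, ENNReal.ofReal ((linearAggregate q Y x - p x) ^ 2) ≤
      (∫⁻ x, ENNReal.ofReal ((q j x - p x) ^ 2)) + excessSup p q Y := by
  have hφ : IsOrthonormalBasisOfSpan q (spanBasis q).2 :=
    Classical.epsilon_spec (exists_isOrthonormalBasisOfSpan q hq)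
  have hmem := linearAggregate_mem_span hq Y
  refine lintegral_sq_sub_le_add_excessSup hp hq Y hmem j (le_of_eq ?_)
  generalize hφdef : (spanBasis q).2 = φ at hφ
  have hφ2 : ∀ k, MemLp (φ k) 2 := fun k => memLp_of_mem_span hq (hφ.mem_span k)
  have hu : linearAggregate q Y - q j ∈ Submodule.span ℝ (Set.range φ) :=
    hφ.span_le hc (Submodule.sub_mem _ hmem (Submodule.subset_span ⟨j, rfl⟩))
  obtain ⟨c, hcu⟩ := (Submodule.mem_span_range_iff_exists_fun ℝ).1 hu
  have hx : ∀ x, linearAggregate q Y x - q j x = (∑ k, c k • φ k) x := fun x => by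
    rw [hcu]; rfl
  have hg : ∀ x, linearAggregate q Y x =
      (∑ k, ((l : ℝ)⁻¹ * ∑ i, φ k (Y i)) • φ k) x := fun x => by
    simp [linearAggregate, hφdef]
  simp_rw [hx, hg]
  rw [integral_sum_smul_mul hφ2 (memLp_finsetSum' _ fun k _ => (hφ2 k).const_smul (c k))]
  have h1 : ∀ k, ∫ x, φ k x * (∑ k', c k' • φ k') x = c k := by
    intro k
    simp_rw [mul_comm (φ k _)]
    rw [integral_sum_smul_mul hφ2 (hφ2 k)]
    simp [hφ.orthonormal]
  simp_rw [h1, Finset.sum_apply, Pi.smul_apply, smul_eq_mul]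
  rw [Finset.sum_comm, Finset.mul_sum]
  refine Finset.sum_congr rfl fun k _ => ?_
  rw [← Finset.mul_sum]
  ring

theorem convexAggregate_mem_span {q : ι → E d → ℝ} (Y : Fin l → E d) :
    convexAggregate q Y ∈ Submodule.span ℝ (Set.range q) := by
  have : convexAggregate q Y = ∑ j, convexWeights q Y j • q j := by
    funext x
    simp [convexAggregate]
  rw [this]
  exact Submodule.sum_mem _ fun k _ => Submodule.smul_mem _ _ (Submodule.subset_span ⟨k, rfl⟩)

theorem lintegral_convexAggregate_sub_sq_le (hp : MemLp p 2) {q : ι → E d → ℝ}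
    (hq : ∀ j, MemLp (q j) 2) (Y : Fin l → E d) (j : ι) :
    ∫⁻ x, ENNReal.ofReal ((convexAggregate q Y x - p x) ^ 2) ≤
      (∫⁻ x, ENNReal.ofReal ((q j x - p x) ^ 2)) + excessSup p q Y := by
  classical
  obtain ⟨hmin, hw, hw1⟩ : IsMinOn (empiricalCriterion q Y) (subSimplex ι) (convexWeights q Y) ∧
      convexWeights q Y ∈ subSimplex ι := Classical.epsilon_spec (exists_convexWeights q hq Y)
  have hmem := convexAggregate_mem_span (q := q) Y
  refine lintegral_sq_sub_le_add_excessSup hp hq Y hmem j ?_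
  set w := convexWeights q Y with hwdef
  set g := convexAggregate q Y with hgdef
  have hg2 : MemLp g 2 := memLp_of_mem_span hq hmem
  have hu2 : MemLp (fun x => g x - q j x) 2 := hg2.sub (hq j)
  set A := ∫ x, g x * (g x - q j x)
  set C := ∫ x, (g x - q j x) ^ 2
  set B := (l : ℝ)⁻¹ * ∑ i, (g (Y i) - q j (Y i)) with hB
  -- Minimality is tested along the segment from `w` to the vertex `e_j` of `Λ`; letting `t → 0`
  -- gives the first order condition `A ≤ B`.
  have key : ∀ t ∈ Set.Ioc (0 : ℝ) 1, A ≤ B + t * (C / 2) := by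
    intro t ht
    let w' : ι → ℝ := fun i => (1 - t) * w i + t * if i = j then 1 else 0
    have hw' : w' ∈ subSimplex ι := by
      refine ⟨fun i => ?_, ?_⟩
      · have := hw i
        have h1 : (0 : ℝ) ≤ if i = j then 1 else 0 := by split_ifs <;> norm_num
        have h2 : 0 ≤ 1 - t := by linarith [ht.2]
        have h3 := ht.1
        simp only [w']
        positivity
      · simp only [w', Finset.sum_add_distrib, ← Finset.mul_sum, Finset.sum_ite_eq',
          Finset.mem_univ, if_true]
        nlinarith [ht.1, ht.2]
    have h1 : ∀ x, ∑ i, w' i * q i x = g x - t * (g x - q j x) := by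
      intro x
      simp only [w', add_mul, Finset.sum_add_distrib, mul_assoc, ← Finset.mul_sum, ite_mul,
        one_mul, zero_mul, Finset.sum_ite_eq', Finset.mem_univ, if_true]
      simp only [hgdef, convexAggregate, ← hwdef]
      ring
    have h2 : ∀ x, ∑ i, w i * q i x = g x := fun x => rfl
    have h3 := isMinOn_iff.1 hmin w' hw'
    simp only [empiricalCriterion, h1, h2] at h3
    have h4 : ∫ x, (g x - t * (g x - q j x)) ^ 2 = (∫ x, g x ^ 2) - 2 * t * A + t ^ 2 * C := by
      have i1 : Integrable fun x => g x ^ 2 := hg2.integrable_sq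
      have i2 : Integrable fun x => g x * (g x - q j x) := hg2.integrable_mul hu2
      have i3 : Integrable fun x => (g x - q j x) ^ 2 := hu2.integrable_sq
      have i4 : Integrable fun x => g x ^ 2 - 2 * t * (g x * (g x - q j x)) :=
        i1.sub (i2.const_mul _)
      rw [← integral_const_mul, ← integral_const_mul, ← integral_sub i1 (i2.const_mul _),
        ← integral_add i4 (i3.const_mul _)]
      refine integral_congr_ae (ae_of_all _ fun x => ?_)
      ring
    rw [h4, Finset.sum_sub_distrib, ← Finset.mul_sum] at h3
    have h5 : 2 / (l : ℝ) * (∑ i, g (Y i) - t * ∑ i, (g (Y i) - q j (Y i))) =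
        2 / (l : ℝ) * ∑ i, g (Y i) - 2 * t * B := by
      rw [hB]; ring
    rw [h5] at h3
    have h6 : 0 ≤ t * (2 * (B - A) + t * C) := by nlinarith
    have h7 := nonneg_of_mul_nonneg_right h6 ht.1
    linarith
  have hlim : Tendsto (fun t : ℝ => B + t * (C / 2)) (𝓝[>] 0) (𝓝 (B + 0 * (C / 2))) := by
    refine Tendsto.mono_left (Continuous.tendsto ?_ 0) nhdsWithin_le_nhds
    fun_prop
  rw [zero_mul, add_zero] at hlim
  refine ge_of_tendsto hlim ?_
  filter_upwards [Ioc_mem_nhdsGT zero_lt_one] with t ht using key t ht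

end

section

/-! ### Averages over splits -/

theorem measurePreserving_split {α κ κ' κ'' : Type*} [Fintype κ] [Fintype κ'] [Fintype κ'']
    [MeasurableSpace α] (μ : Measure α) [SigmaFinite μ] (s : κ ⊕ κ' ≃ κ'') :
    MeasurePreserving
      (fun X : κ'' → α => ((fun i => X (s (Sum.inl i))), fun i => X (s (Sum.inr i))))
      (Measure.pi fun _ => μ) ((Measure.pi fun _ : κ => μ).prod (Measure.pi fun _ : κ' => μ)) := by
  have h1 := (measurePreserving_piCongrLeft (fun _ : κ'' => μ) s).symm
  have h2 := measurePreserving_sumPiEquivProdPi (fun _ : κ ⊕ κ' => μ)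
  exact h2.comp h1

variable {d : ℕ} {L : ℝ} {p : E d → ℝ} {ι : Type} [Fintype ι] {n : ℕ}

theorem measurable_split (s : Split n) :
    Measurable fun X : Fin n → E d => (trainSample s X, validSample s X) := by
  unfold trainSample validSample
  fun_prop

theorem lintegral_split (hp : IsBoundedDensity p L) (s : Split n)
    {f : (Fin (trainSize n) → E d) × (Fin (n - trainSize n) → E d) → ENNReal}
    (hf : Measurable f) :
    ∫⁻ X, f (trainSample s X, validSample s X) ∂(sampleLaw n p) =
      ∫⁻ T, ∫⁻ Y, f (T, Y) ∂(sampleLaw (n - trainSize n) p) ∂(sampleLaw (trainSize n) p) := by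
  have := hp.isProbabilityMeasure
  have h := (measurePreserving_split (densityMeasure p) s).lintegral_comp hf
  rw [lintegral_prod _ hf.aemeasurable] at h
  exact h

theorem sq_average_sub_le {κ : Type*} {S : Finset κ} (hS : S.Nonempty) (f : κ → ℝ) (c : ℝ) :
    ((S.card : ℝ)⁻¹ * ∑ s ∈ S, f s - c) ^ 2 ≤ (S.card : ℝ)⁻¹ * ∑ s ∈ S, (f s - c) ^ 2 := by
  have h0 : (0 : ℝ) < S.card := by exact_mod_cast hS.card_pos
  have h1 := sq_sum_le_card_mul_sum_sq (s := S) (f := fun s => f s - c)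
  have h2 : (S.card : ℝ)⁻¹ * ∑ s ∈ S, f s - c = (S.card : ℝ)⁻¹ * ∑ s ∈ S, (f s - c) := by
    rw [Finset.sum_sub_distrib, Finset.sum_const, nsmul_eq_mul]
    field_simp
  rw [h2, mul_pow, sq, mul_assoc]
  refine mul_le_mul_of_nonneg_left ?_ (by positivity)
  rw [inv_mul_le_iff₀ h0]
  exact h1

/-- Convexity of the square reduces to one split, and every split has the same law: independent
training and validation samples. -/
theorem risk_average_le (hp : IsBoundedDensity p L) (hl : 0 < n - trainSize n)
    {S : Finset (Split n)} (hS : S.Nonempty) {q : ι → (Fin (trainSize n) → E d) → E d → ℝ}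
    (hqc : ∀ j, Continuous fun z : (Fin (trainSize n) → E d) × E d => q j z.1 z.2)
    (hq : ∀ j T, MemLp (q j T) 2)
    {agg : (Fin (trainSize n) → E d) → (Fin (n - trainSize n) → E d) → E d → ℝ}
    (hagg : ∀ T Y, Continuous (agg T Y))
    (h : ∀ T Y j, ∫⁻ x, ENNReal.ofReal ((agg T Y x - p x) ^ 2) ≤
      (∫⁻ x, ENNReal.ofReal ((q j T x - p x) ^ 2)) + excessSup p (fun j => q j T) Y) (j : ι) :
    risk (fun (X : Fin n → E d) x => (S.card : ℝ)⁻¹ * ∑ s ∈ S,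
      agg (trainSample s X) (validSample s X) x) p ≤
      risk (q j) p + ENNReal.ofReal (L * Fintype.card ι / (n - trainSize n : ℕ)) := by
  have := hp.isProbabilityMeasure
  have hlaw : ∀ k, IsProbabilityMeasure (sampleLaw k p) := fun k =>
    inferInstanceAs (IsProbabilityMeasure (Measure.pi fun _ : Fin k => densityMeasure p))
  let R : (Fin (trainSize n) → E d) → ENNReal := fun T =>
    ∫⁻ x, ENNReal.ofReal ((q j T x - p x) ^ 2)
  let G : (Fin (trainSize n) → E d) × (Fin (n - trainSize n) → E d) → ENNReal := fun z =>
    excessSup p (fun j => q j z.1) z.2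
  have hR : Measurable R := by
    have : Measurable fun z : (Fin (trainSize n) → E d) × E d =>
        ENNReal.ofReal ((q j z.1 z.2 - p z.2) ^ 2) :=
      (((hqc j).measurable.sub (hp.measurable.comp measurable_snd)).pow_const 2).ennreal_ofReal
    exact this.lintegral_prod_right'
  have hG : Measurable G :=
    measurable_excessSup (fun j => (hqc j).measurable) hq hp.memLp_two hp.measurable
  have hRG : Measurable fun z : (Fin (trainSize n) → E d) × (Fin (n - trainSize n) → E d) =>
      R z.1 + G z := (hR.comp measurable_fst).add hG
  let c : ENNReal := ENNReal.ofReal (S.card : ℝ)⁻¹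
  -- The aggregates depend on arbitrary choices of bases or minimizers and need not be measurable in
  -- the sample; this pointwise majorant is.
  have hpt : ∀ X : Fin n → E d, ∫⁻ x, ENNReal.ofReal (((S.card : ℝ)⁻¹ * ∑ s ∈ S,
      agg (trainSample s X) (validSample s X) x - p x) ^ 2) ≤
      c * ∑ s ∈ S, (R (trainSample s X) + G (trainSample s X, validSample s X)) := by
    intro X
    calc ∫⁻ x, ENNReal.ofReal (((S.card : ℝ)⁻¹ * ∑ s ∈ S,
          agg (trainSample s X) (validSample s X) x - p x) ^ 2)
        ≤ ∫⁻ x, c * ∑ s ∈ S, ENNReal.ofReal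
            ((agg (trainSample s X) (validSample s X) x - p x) ^ 2) := by
          refine lintegral_mono fun x => ?_
          rw [← ENNReal.ofReal_sum_of_nonneg fun _ _ => sq_nonneg _,
            ← ENNReal.ofReal_mul (by positivity)]
          exact ENNReal.ofReal_le_ofReal (sq_average_sub_le hS _ _)
      _ = c * ∑ s ∈ S, ∫⁻ x, ENNReal.ofReal
            ((agg (trainSample s X) (validSample s X) x - p x) ^ 2) := by
          rw [lintegral_const_mul' _ _ ENNReal.ofReal_ne_top, lintegral_finsetSum]
          exact fun s _ => (((hagg _ _).measurable.sub hp.measurable).pow_const 2).ennreal_ofReal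
      _ ≤ _ := by
          gcongr with s
          exact h _ _ j
  have hRGs : ∀ s : Split n, Measurable fun X : Fin n → E d =>
      R (trainSample s X) + G (trainSample s X, validSample s X) := fun s => by
    have h1 := hRG.comp (measurable_split s)
    exact h1
  have hs : ∀ s : Split n, ∫⁻ X, (R (trainSample s X) + G (trainSample s X, validSample s X))
      ∂(sampleLaw n p) ≤
      risk (q j) p + ENNReal.ofReal (L * Fintype.card ι / (n - trainSize n : ℕ)) := by
    intro s
    rw [lintegral_split hp s hRG]
    have h2 : ∀ T : Fin (trainSize n) → E d,
        ∫⁻ Y, (R T + G (T, Y)) ∂(sampleLaw (n - trainSize n) p) ≤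
        R T + ENNReal.ofReal (L * Fintype.card ι / (n - trainSize n : ℕ)) := by
      intro T
      rw [lintegral_add_left measurable_const, lintegral_const, measure_univ, mul_one]
      refine add_le_add_right (lintegral_excessSup_le hp hl (fun j => ?_) fun j => hq j T) _
      exact (hqc j).comp (Continuous.prodMk_right T)
    refine (lintegral_mono h2).trans (le_of_eq ?_)
    rw [lintegral_add_left hR, lintegral_const, measure_univ, mul_one]
    rfl
  refine (lintegral_mono hpt).trans ?_
  rw [lintegral_const_mul' _ _ ENNReal.ofReal_ne_top, lintegral_finsetSum]
  swap
  · exact fun s _ => hRGs s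
  refine (mul_le_mul_right (Finset.sum_le_sum fun s _ => hs s) _).trans (le_of_eq ?_)
  have h0 : (0 : ℝ) < S.card := by exact_mod_cast hS.card_pos
  rw [Finset.sum_const, nsmul_eq_mul, ← mul_assoc, ← ENNReal.ofReal_natCast,
    ← ENNReal.ofReal_mul (by positivity), inv_mul_cancel₀ h0.ne', ENNReal.ofReal_one, one_mul]

end

section

variable {d : ℕ} {b h β Q L : ℝ} {p : E d → ℝ}

/-! ### The aggregates of the kernel estimators -/

theorem h0_pos {n : ℕ} (hn : 2 ≤ n) : 0 < h0 d n := by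
  have h1 : (1 : ℝ) < n := by exact_mod_cast hn
  exact Real.rpow_pos_of_pos (mul_pos (by linarith) (Real.log_pos h1)) _

theorem gridRatio_gt_one {a₀ : ℝ} (ha : 0 < a₀) {n : ℕ} (hn : 2 ≤ n) : 1 < gridRatio a₀ n := by
  have h1 : (1 : ℝ) < n := by exact_mod_cast hn
  have := div_pos ha (Real.log_pos h1)
  unfold gridRatio
  linarith

theorem bandwidth_pos {a₀ : ℝ} (ha : 0 < a₀) {n : ℕ} (hn : 2 ≤ n)
    (j : Fin (numBandwidths d a₀ n)) : 0 < bandwidth d a₀ n j := by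
  unfold bandwidth
  have h1 := gridRatio_gt_one ha hn
  have h2 : 0 < h0 d n := h0_pos hn
  split_ifs <;> positivity

theorem smoothnessGrid_pos (hd : 1 ≤ d) {N : ℕ} (k : Fin N) : 0 < smoothnessGrid d N k := by
  have : (0 : ℝ) < d := by exact_mod_cast hd
  unfold smoothnessGrid
  positivity

theorem continuous_kernelEstimator {m : ℕ} (hb : 0 < b) (hh : 0 < h) :
    Continuous fun z : (Fin m → E d) × E d =>
      kernelEstimator (pinskerKernel d b) h z.1 z.2 := by
  have hc := continuous_scaledKernel (d := d) hb hh
  simp_rw [kernelEstimator_eq]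
  fun_prop

theorem memLp_kernelEstimator {m : ℕ} (hb : 0 < b) (hh : 0 < h) (T : Fin m → E d) :
    MemLp (kernelEstimator (pinskerKernel d b) h T) 2 := by
  have h1 : kernelEstimator (pinskerKernel d b) h T =
      fun x => (m : ℝ)⁻¹ * ∑ i, scaledKernel d b h (T i - x) := funext fun x =>
    kernelEstimator_eq T x
  rw [h1]
  have h2 : ∀ i, MemLp (fun x => scaledKernel d b h (T i - x)) 2 := fun i =>
    (memLp_scaledKernel hb hh).comp_measurePreserving (Measure.measurePreserving_sub_left volume (T i))
  have h3 : MemLp (fun x => ∑ i, scaledKernel d b h (T i - x)) 2 :=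
    memLp_finsetSum _ fun i _ => h2 i
  exact h3.const_mul _

/-- The oracle bound for an averaged aggregate. -/
def aggregateRiskBound (d : ℕ) (a₀ β Q b h : ℝ) (n N : ℕ) : ℝ :=
  kernelRiskBound d β Q b h (trainSize n) +
    sobolevSupBound d β Q * (N * numBandwidths d a₀ n) / (n - trainSize n : ℕ)

theorem risk_average_kernel_aggregate_le (hd : 1 ≤ d) {a₀ : ℝ} (ha : 0 < a₀)
    (hβ : (d : ℝ) / 2 < β) (hQ : 0 < Q) {n : ℕ} (hn : 2 ≤ n) (hm : 0 < trainSize n)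
    (hl : trainSize n < n) {S : Finset (Split n)} (hS : S.Nonempty) {N : ℕ} (k : Fin N)
    (hk : β ≤ smoothnessGrid d N k) (j : Fin (numBandwidths d a₀ n))
    (agg : (Fin N × Fin (numBandwidths d a₀ n) → E d → ℝ) →
      (Fin (n - trainSize n) → E d) → E d → ℝ)
    (hspan : ∀ q Y, (∀ i, MemLp (q i) 2) → agg q Y ∈ Submodule.span ℝ (Set.range q))
    (hagg : ∀ (p : E d → ℝ), MemLp p 2 → ∀ q Y, (∀ i, Continuous (q i)) → (∀ i, MemLp (q i) 2) →
      ∀ i, ∫⁻ x, ENNReal.ofReal ((agg q Y x - p x) ^ 2) ≤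
      (∫⁻ x, ENNReal.ofReal ((q i x - p x) ^ 2)) + excessSup p q Y)
    (hp : p ∈ sobolevClass d β Q) :
    risk (fun (X : Fin n → E d) x => (S.card : ℝ)⁻¹ * ∑ s ∈ S,
      agg (initialEstimators d a₀ n N (trainSample s X)) (validSample s X) x) p ≤
      ENNReal.ofReal (aggregateRiskBound d a₀ β Q (smoothnessGrid d N k)
        (bandwidth d a₀ n j) n N) := by
  obtain ⟨p', hp', hpp', hB⟩ := exists_isBoundedDensity_ae_eq hβ hQ hp
  rw [risk_congr_ae _ hpp']
  have hb : ∀ i : Fin N × Fin (numBandwidths d a₀ n), 0 < smoothnessGrid d N i.1 := fun i =>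
    smoothnessGrid_pos hd i.1
  have hh : ∀ i : Fin N × Fin (numBandwidths d a₀ n), 0 < bandwidth d a₀ n i.2 := fun i =>
    bandwidth_pos ha hn i.2
  have hqc : ∀ i, Continuous fun z : (Fin (trainSize n) → E d) × E d =>
      initialEstimators d a₀ n N z.1 i z.2 := fun i => continuous_kernelEstimator (hb i) (hh i)
  have hqc' : ∀ (T : Fin (trainSize n) → E d) i, Continuous (initialEstimators d a₀ n N T i) :=
    fun T i => by
      have h := (hqc i).comp (Continuous.prodMk_right T)
      exact h
  have hq : ∀ (T : Fin (trainSize n) → E d) i, MemLp (initialEstimators d a₀ n N T i) 2 :=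
    fun T i => memLp_kernelEstimator (hb i) (hh i) T
  have h1 := risk_average_le hB (Nat.sub_pos_of_lt hl) hS
    (q := fun i T => initialEstimators d a₀ n N T i) hqc (fun i T => hq T i)
    (agg := fun T Y => agg (initialEstimators d a₀ n N T) Y)
    (fun T Y => continuous_of_mem_span (hqc' T) (hspan _ _ (hq T)))
    (fun T Y i => hagg p' hB.memLp_two _ Y (hqc' T) (hq T) i) (k, j)
  refine h1.trans ((add_le_add_left
    (risk_kernelEstimator_le hβ hQ hk (hh (k, j)) hm hp' hB) _).trans (le_of_eq ?_))
  have hE := pinskerEnergy_nonneg (d := d) (b := smoothnessGrid d N k)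
  have hh' := hh (k, j)
  have hL : 0 ≤ sobolevSupBound d β Q := sobolevSupBound_nonneg hQ
  rw [← ENNReal.ofReal_add (by unfold kernelRiskBound; positivity) (by positivity)]
  simp [aggregateRiskBound]

theorem risk_averagedLinearAggregate_le (hd : 1 ≤ d) {a₀ : ℝ} (ha : 0 < a₀)
    (hβ : (d : ℝ) / 2 < β) (hQ : 0 < Q) {n : ℕ} (hn : 2 ≤ n) (hm : 0 < trainSize n)
    (hl : trainSize n < n) {S : Finset (Split n)} (hS : S.Nonempty) {N : ℕ} (k : Fin N)
    (hk : β ≤ smoothnessGrid d N k) (j : Fin (numBandwidths d a₀ n))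
    (hp : p ∈ sobolevClass d β Q) :
    risk (averagedLinearAggregate d a₀ n N S) p ≤
      ENNReal.ofReal (aggregateRiskBound d a₀ β Q (smoothnessGrid d N k)
        (bandwidth d a₀ n j) n N) :=
  risk_average_kernel_aggregate_le hd ha hβ hQ hn hm hl hS k hk j linearAggregate
    (fun _ Y hq => linearAggregate_mem_span hq Y)
    (fun _ hp _ Y hc hq i => lintegral_linearAggregate_sub_sq_le hp hc hq Y i) hp

theorem risk_averagedConvexAggregate_le (hd : 1 ≤ d) {a₀ : ℝ} (ha : 0 < a₀)
    (hβ : (d : ℝ) / 2 < β) (hQ : 0 < Q) {n : ℕ} (hn : 2 ≤ n) (hm : 0 < trainSize n)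
    (hl : trainSize n < n) {S : Finset (Split n)} (hS : S.Nonempty) {N : ℕ} (k : Fin N)
    (hk : β ≤ smoothnessGrid d N k) (j : Fin (numBandwidths d a₀ n))
    (hp : p ∈ sobolevClass d β Q) :
    risk (averagedConvexAggregate d a₀ n N S) p ≤
      ENNReal.ofReal (aggregateRiskBound d a₀ β Q (smoothnessGrid d N k)
        (bandwidth d a₀ n j) n N) :=
  risk_average_kernel_aggregate_le hd ha hβ hQ hn hm hl hS k hk j convexAggregate
    (fun _ Y _ => convexAggregate_mem_span Y)
    (fun _ hp _ Y _ hq i => lintegral_convexAggregate_sub_sq_le hp hq Y i) hp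

/-! ### The Pinsker constant -/

theorem sphereSurface_pos (hd : 1 ≤ d) : 0 < sphereSurface d := by
  have h1 : (0 : ℝ) < d := by exact_mod_cast hd
  have := Real.Gamma_pos_of_pos (s := (d : ℝ) / 2) (by positivity)
  unfold sphereSurface
  positivity

theorem mul_volume_ball_eq_sphereSurface (hd : 1 ≤ d) :
    d * volume.real (Metric.ball (0 : E d) 1) = sphereSurface d := by
  have h1 : (0 : ℝ) < d := by exact_mod_cast hd
  have : Nonempty (Fin d) := ⟨⟨0, hd⟩⟩
  have hG := Real.Gamma_pos_of_pos (s := (d : ℝ) / 2) (by positivity)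
  have hG1 := Real.Gamma_add_one (s := (d : ℝ) / 2) (by positivity)
  rw [Measure.real, EuclideanSpace.volume_ball, Fintype.card_fin, ENNReal.ofReal_one, one_pow,
    one_mul, hG1, ENNReal.toReal_ofReal (by positivity), sphereSurface, Real.sqrt_eq_rpow,
    ← Real.rpow_natCast, ← Real.rpow_mul Real.pi_pos.le]
  rw [show (1 : ℝ) / 2 * d = d / 2 by ring]
  field_simp

theorem pinskerEnergy_eq (hd : 1 ≤ d) (hb : 0 < b) :
    pinskerEnergy d b = sphereSurface d * (2 * b ^ 2 / (d * (b + d) * (2 * b + d))) := by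
  have h1 : (0 : ℝ) < d := by exact_mod_cast hd
  have : Nonempty (Fin d) := ⟨⟨0, hd⟩⟩
  have hnt : Nontrivial (E d) := by
    have : 0 < Module.finrank ℝ (E d) := by rw [finrank_euclideanSpace_fin]; omega
    exact Module.nontrivial_of_finrank_pos this
  have h2 := integral_fun_norm_addHaar (volume : Measure (E d))
    (fun r : ℝ => (max (1 - r ^ b) 0) ^ 2)
  rw [finrank_euclideanSpace_fin, nsmul_eq_mul, smul_eq_mul, ← mul_assoc,
    mul_volume_ball_eq_sphereSurface hd] at h2
  refine Eq.trans h2 ?_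
  congr 1
  have h3 : ∫ y in Set.Ioi (0 : ℝ), y ^ (d - 1) • (max (1 - y ^ b) 0) ^ 2 =
      ∫ y in Set.Ioc (0 : ℝ) 1, y ^ (d - 1) • (max (1 - y ^ b) 0) ^ 2 := by
    refine setIntegral_eq_of_subset_of_forall_sdiff_eq_zero measurableSet_Ioi
      Set.Ioc_subset_Ioi_self fun y hy => ?_
    have hy1 : 1 ≤ y := by
      by_contra hlt
      exact hy.2 ⟨hy.1, (not_le.1 hlt).le⟩
    have := Real.one_le_rpow hy1 hb.le
    rw [max_eq_right (by linarith)]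
    simp
  -- In polar coordinates the square expands into three powers, and `1/d - 2/(b+d) + 1/(2b+d)` is
  -- the claimed fraction.
  have h4 : ∫ y in Set.Ioc (0 : ℝ) 1, y ^ (d - 1) • (max (1 - y ^ b) 0) ^ 2 =
      ∫ y in Set.Ioc (0 : ℝ) 1, (y ^ ((d : ℝ) - 1) - 2 * y ^ (b + d - 1) +
        y ^ (2 * b + d - 1)) := by
    refine setIntegral_congr_fun measurableSet_Ioc fun y hy => ?_
    have hy1 := Real.rpow_le_one hy.1.le hy.2 hb.le
    have e1 : y ^ (d - 1) = y ^ ((d : ℝ) - 1) := by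
      rw [← Real.rpow_natCast, Nat.cast_sub hd, Nat.cast_one]
    have e2 : y ^ (b + d - 1) = y ^ ((d : ℝ) - 1) * y ^ b := by
      rw [← Real.rpow_add hy.1]; ring_nf
    have e3 : y ^ (2 * b + d - 1) = y ^ ((d : ℝ) - 1) * (y ^ b * y ^ b) := by
      rw [← Real.rpow_add hy.1, ← Real.rpow_add hy.1]; ring_nf
    simp only [smul_eq_mul]
    rw [max_eq_left (by linarith), e1, e2, e3]
    ring
  have hi : ∀ s : ℝ, -1 < s → IntervalIntegrable (fun y : ℝ => y ^ s) volume 0 1 := fun s hs =>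
    intervalIntegral.intervalIntegrable_rpow' hs
  have i1 := hi ((d : ℝ) - 1) (by linarith)
  have i2 := (hi (b + d - 1) (by linarith)).const_mul 2
  have i3 := hi (2 * b + d - 1) (by linarith)
  rw [h3, h4, ← intervalIntegral.integral_of_le zero_le_one,
    intervalIntegral.integral_add (i1.sub i2) i3, intervalIntegral.integral_sub i1 i2,
    intervalIntegral.integral_const_mul, integral_rpow (Or.inl (by linarith)),
    integral_rpow (Or.inl (by linarith)), integral_rpow (Or.inl (by linarith))]
  simp only [sub_add_cancel, Real.one_rpow]
  rw [Real.zero_rpow (by positivity), Real.zero_rpow (by positivity), Real.zero_rpow (by positivity)]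
  field_simp
  ring

theorem pinskerConstant_pos (hd : 1 ≤ d) (hβ : 0 < β) (hQ : 0 < Q) :
    0 < pinskerConstant d β Q := by
  have h1 : (0 : ℝ) < d := by exact_mod_cast hd
  have := sphereSurface_pos hd
  unfold pinskerConstant
  positivity

/-- The constant of the optimal bandwidth `(c / n)^(1 / (2β + d))`. -/
def bandwidthConstant (d : ℕ) (β Q : ℝ) : ℝ := d * pinskerEnergy d β / (2 * β * Q)

/-- The definition is the critical point equation of `h^{2β} Q + E / (n h^d)`, namely `h^{2β+d} = dE
/ (2βQn)`. The present form is the quotient of the two bases occurring in `C*`. -/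
theorem bandwidthConstant_eq (hd : 1 ≤ d) (hβ : 0 < β) (hQ : 0 < Q) :
    bandwidthConstant d β Q =
      (β * sphereSurface d / (β + d)) * (Q * (2 * β + d))⁻¹ := by
  have h1 : (0 : ℝ) < d := by exact_mod_cast hd
  rw [bandwidthConstant, pinskerEnergy_eq hd hβ]
  field_simp

theorem bandwidthConstant_pos (hd : 1 ≤ d) (hβ : 0 < β) (hQ : 0 < Q) :
    0 < bandwidthConstant d β Q := by
  have h1 : (0 : ℝ) < d := by exact_mod_cast hd
  have := sphereSurface_pos hd
  rw [bandwidthConstant_eq hd hβ hQ]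
  positivity

theorem pinskerConstant_eq (hd : 1 ≤ d) (hβ : 0 < β) (hQ : 0 < Q) :
    ((2 * Real.pi) ^ d)⁻¹ * (bandwidthConstant d β Q ^ (2 * β / (2 * β + d)) * Q +
      bandwidthConstant d β Q ^ (-(d / (2 * β + d))) * pinskerEnergy d β) =
      pinskerConstant d β Q := by
  have h1 : (0 : ℝ) < d := by exact_mod_cast hd
  have hS := sphereSurface_pos hd
  have hc := bandwidthConstant_pos hd hβ hQ
  -- At the optimum the variance is `2β/d` times the squared bias, so both terms are multiples of
  -- one power of the constant.
  have hE : pinskerEnergy d β = bandwidthConstant d β Q * (2 * β * Q / d) := by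
    rw [bandwidthConstant]; field_simp
  have e1 : -((d : ℝ) / (2 * β + d)) = 2 * β / (2 * β + d) - 1 := by field_simp; ring
  have e2 : (d : ℝ) / (2 * β + d) = 1 - 2 * β / (2 * β + d) := by field_simp; ring
  rw [hE, e1, Real.rpow_sub hc, Real.rpow_one, pinskerConstant, e2,
    Real.rpow_sub (by positivity), Real.rpow_one]
  have h2 : bandwidthConstant d β Q ^ (2 * β / (2 * β + d)) =
      (β * sphereSurface d / (β + d)) ^ (2 * β / (2 * β + d)) *
        ((Q * (2 * β + d)) ^ (2 * β / (2 * β + d)))⁻¹ := by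
    rw [bandwidthConstant_eq hd hβ hQ, Real.mul_rpow (by positivity) (by positivity),
      Real.inv_rpow (by positivity)]
  rw [h2]
  have h3 : 0 < (Q * (2 * β + d)) ^ (2 * β / (2 * β + d)) := by positivity
  have h4 : 0 < (β * sphereSurface d / (β + d)) ^ (2 * β / (2 * β + d)) := by positivity
  generalize (Q * (2 * β + d)) ^ (2 * β / (2 * β + d)) = A at *
  generalize (β * sphereSurface d / (β + d)) ^ (2 * β / (2 * β + d)) = B at *
  field_simp
  ring

end

section

variable {d : ℕ} {β Q : ℝ}

/-! ### Asymptotics -/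

theorem tendsto_log_natCast : Tendsto (fun n : ℕ => Real.log n) atTop atTop :=
  Real.tendsto_log_atTop.comp tendsto_natCast_atTop_atTop

theorem one_lt_log {n : ℕ} (hn : 3 ≤ n) : 1 < Real.log n := by
  have h3 : (3 : ℝ) ≤ n := by exact_mod_cast hn
  rw [Real.lt_log_iff_exp_lt (by linarith)]
  exact Real.exp_one_lt_three.trans_le h3

theorem trainSize_le {n : ℕ} (hn : 3 ≤ n) :
    (trainSize n : ℝ) ≤ n * (1 - (Real.log n)⁻¹) := by
  refine Nat.floor_le (mul_nonneg (Nat.cast_nonneg _) ?_)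
  have := inv_lt_one_of_one_lt₀ (one_lt_log hn)
  linarith

theorem trainSize_lt {n : ℕ} (hn : 3 ≤ n) : trainSize n < n := by
  have h1 := trainSize_le hn
  have h2 : 0 < (Real.log n)⁻¹ := inv_pos.2 (zero_lt_one.trans (one_lt_log hn))
  have h3 : (0 : ℝ) < n := by exact_mod_cast (by omega : 0 < n)
  have : (trainSize n : ℝ) < n := by nlinarith
  exact_mod_cast this

theorem div_log_le_sub_trainSize {n : ℕ} (hn : 3 ≤ n) :
    n / Real.log n ≤ ((n - trainSize n : ℕ) : ℝ) := by
  rw [Nat.cast_sub (trainSize_lt hn).le, div_eq_mul_inv]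
  linarith [trainSize_le hn]

theorem tendsto_div_trainSize :
    Tendsto (fun n : ℕ => (n : ℝ) / trainSize n) atTop (𝓝 1) := by
  have h1 : Tendsto (fun n : ℕ => (trainSize n : ℝ) / n) atTop (𝓝 1) := by
    have hlow : Tendsto (fun n : ℕ => 1 - (Real.log n)⁻¹ - (n : ℝ)⁻¹) atTop (𝓝 (1 - 0 - 0)) :=
      (tendsto_const_nhds.sub tendsto_log_natCast.inv_tendsto_atTop).sub
        (tendsto_natCast_atTop_atTop (R := ℝ)).inv_tendsto_atTop
    simp only [sub_zero] at hlow
    refine tendsto_of_tendsto_of_tendsto_of_le_of_le' hlow tendsto_const_nhds ?_ ?_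
    · filter_upwards [eventually_ge_atTop 3] with n hn
      have h3 : (0 : ℝ) < n := by exact_mod_cast (by omega : 0 < n)
      rw [le_div_iff₀ h3]
      have := (Nat.lt_floor_add_one ((n : ℝ) * (1 - (Real.log n)⁻¹))).le
      have h4 : (1 - (Real.log n)⁻¹ - (n : ℝ)⁻¹) * n = n * (1 - (Real.log n)⁻¹) - 1 := by
        field_simp
      rw [h4]
      unfold trainSize
      linarith
    · filter_upwards [eventually_ge_atTop 3] with n hn
      have h3 : (0 : ℝ) < n := by exact_mod_cast (by omega : 0 < n)
      rw [div_le_one h3]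
      exact_mod_cast (trainSize_lt hn).le
  have h2 := h1.inv₀ one_ne_zero
  rw [inv_one] at h2
  refine h2.congr fun n => ?_
  rw [inv_div]

/-! ### The bandwidth grid: size and fineness. -/

theorem tendsto_gridRatio (a₀ : ℝ) : Tendsto (gridRatio a₀) atTop (𝓝 1) := by
  have := (tendsto_const_nhds (x := (1 : ℝ))).add
    ((tendsto_const_nhds (x := a₀)).div_atTop tendsto_log_natCast)
  rw [add_zero] at this
  exact this

/-- On the logarithmic scale a length `(log n + log log n)/d ≤ 2 log n` is covered by steps of size
at least `a₀ / (log n + a₀)`. -/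
theorem natCast_le_of_h0_mul_pow_lt_one (hd : 1 ≤ d) {a₀ : ℝ} (ha : 0 < a₀) {n : ℕ} (hn : 3 ≤ n)
    {j : ℕ} (hj : h0 d n * gridRatio a₀ n ^ j < 1) :
    (j : ℝ) ≤ 2 * (1 + a₀) / a₀ * Real.log n ^ 2 := by
  have hd' : (1 : ℝ) ≤ d := by exact_mod_cast hd
  have hn0 : (0 : ℝ) < n := by exact_mod_cast (by omega : 0 < n)
  have hlog := one_lt_log hn
  set l := Real.log n with hl
  have hg := gridRatio_gt_one ha (n := n) (by omega)
  have hh0 : 0 < h0 d n := h0_pos (by omega)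
  have h1 := Real.log_neg (by positivity) hj
  rw [Real.log_mul hh0.ne' (by positivity), Real.log_pow] at h1
  have h2 : Real.log (h0 d n) = -1 / d * (l + Real.log l) := by
    rw [h0, Real.log_rpow (by positivity), Real.log_mul hn0.ne' (by positivity)]
  have h3 : Real.log l ≤ l := by
    have := Real.log_le_sub_one_of_pos (x := l) (by linarith)
    linarith
  have h3' : 0 ≤ Real.log l := Real.log_nonneg hlog.le
  have h4 : a₀ / (l + a₀) ≤ Real.log (gridRatio a₀ n) := by
    have := Real.one_sub_inv_le_log_of_pos (x := gridRatio a₀ n) (by linarith)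
    refine le_trans (le_of_eq ?_) this
    simp only [gridRatio, ← hl]
    field_simp
    ring
  have h5 : (1 : ℝ) / d * (l + Real.log l) ≤ 2 * l := by
    have : (1 : ℝ) / d ≤ 1 := by rw [div_le_one (by linarith)]; exact hd'
    nlinarith
  have h6 : (j : ℝ) * (a₀ / (l + a₀)) ≤ 2 * l := by
    have h7 : (j : ℝ) * (a₀ / (l + a₀)) ≤ j * Real.log (gridRatio a₀ n) := by gcongr
    have h8 : -1 / (d : ℝ) * (l + Real.log l) = -(1 / d * (l + Real.log l)) := by ring
    rw [h2, h8] at h1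
    linarith
  have h9 : (j : ℝ) * a₀ ≤ 2 * l * (l + a₀) := by
    rw [← mul_div_assoc, div_le_iff₀ (by linarith)] at h6
    exact h6
  rw [div_mul_eq_mul_div, le_div_iff₀ ha]
  nlinarith [mul_pos ha (zero_lt_one.trans hlog)]

/-- Boundedness of the index set matters twice: it controls the number of bandwidths, and it
prevents `sSup` from taking the default value of unbounded sets. -/
theorem lastIndex_spec (hd : 1 ≤ d) {a₀ : ℝ} (ha : 0 < a₀) {n : ℕ} (hn : 3 ≤ n) :
    (lastIndex d a₀ n : ℝ) ≤ 2 * (1 + a₀) / a₀ * Real.log n ^ 2 ∧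
      ∀ j, h0 d n * gridRatio a₀ n ^ j < 1 → j ≤ lastIndex d a₀ n := by
  have h1 : ⌊2 * (1 + a₀) / a₀ * Real.log n ^ 2⌋₊ ∈
      upperBounds {j : ℕ | h0 d n * gridRatio a₀ n ^ j < 1} := fun j hj =>
    Nat.le_floor (natCast_le_of_h0_mul_pow_lt_one hd ha hn hj)
  constructor
  · have h2 : lastIndex d a₀ n ≤ ⌊2 * (1 + a₀) / a₀ * Real.log n ^ 2⌋₊ := csSup_le' h1
    refine le_trans (by exact_mod_cast h2) (Nat.floor_le (by positivity))
  · exact fun j hj => le_csSup ⟨_, h1⟩ hj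

theorem exists_bandwidth (hd : 1 ≤ d) {a₀ : ℝ} (ha : 0 < a₀) {n : ℕ} (hn : 3 ≤ n) {H : ℝ}
    (hH : h0 d n ≤ H) (hH1 : H < 1) :
    ∃ j, H / gridRatio a₀ n ≤ bandwidth d a₀ n j ∧ bandwidth d a₀ n j ≤ H := by
  have hh0 : 0 < h0 d n := h0_pos (by omega)
  have hg := gridRatio_gt_one ha (n := n) (by omega)
  obtain ⟨j, hj1, hj2⟩ := exists_nat_pow_near ((one_le_div hh0).2 hH) hg
  rw [le_div_iff₀ hh0] at hj1
  rw [div_lt_iff₀ hh0] at hj2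
  -- Since `H < 1`, the grid point just below `H` is in the geometric part, so the extra bandwidth
  -- `1` is not needed.
  have hj : j ≤ lastIndex d a₀ n := (lastIndex_spec hd ha hn).2 j (by linarith)
  refine ⟨⟨j, by unfold numBandwidths; omega⟩, ?_⟩
  simp only [bandwidth, if_pos hj]
  refine ⟨?_, hj1⟩
  rw [div_le_iff₀ (by linarith)]
  rw [pow_succ] at hj2
  linarith

/-- There are `O((log n)^{ν+2})` estimators and `ℓ ≥ n / log n`, so the cost is `O((log n)^{ν+3} /
n)`. -/
theorem tendsto_estimation_cost (hd : 1 ≤ d) {a₀ : ℝ} (ha : 0 < a₀) {N : ℕ → ℕ} {ν : ℝ}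
    (hNν : IsBoundedUnder (· ≤ ·) atTop fun n : ℕ => (N n : ℝ) / Real.log n ^ ν)
    {L γ : ℝ} (hL : 0 ≤ L) (hγ : γ < 1) :
    Tendsto (fun n : ℕ => L * (N n * numBandwidths d a₀ n) / (n - trainSize n : ℕ) *
      (n : ℝ) ^ γ) atTop (𝓝 0) := by
  obtain ⟨C₀, hC₀⟩ := hNν
  rw [eventually_map] at hC₀
  let C := max C₀ 0
  let K := 2 * (1 + a₀) / a₀ + 2
  have hlim : Tendsto (fun n : ℕ => L * (C * K) *
      (Real.log n ^ (ν + 3) / (n : ℝ) ^ (1 - γ))) atTop (𝓝 0) := by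
    have h1 := (isLittleO_log_rpow_rpow_atTop (ν + 3) (s := 1 - γ) (by linarith)).tendsto_div_nhds_zero
    have h2 := (h1.comp tendsto_natCast_atTop_atTop (α := ℕ)).const_mul (L * (C * K))
    rw [mul_zero] at h2
    exact h2
  refine tendsto_of_tendsto_of_tendsto_of_le_of_le' tendsto_const_nhds hlim ?_ ?_
  · exact Eventually.of_forall fun n => by positivity
  · filter_upwards [hC₀, eventually_ge_atTop 3] with n h1 hn
    have hn0 : (0 : ℝ) < n := by exact_mod_cast (by omega : 0 < n)
    have hlog := one_lt_log hn
    have hl := div_log_le_sub_trainSize hn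
    have hM := (lastIndex_spec hd ha hn).1
    have hM' : (numBandwidths d a₀ n : ℝ) ≤ K * Real.log n ^ 2 := by
      simp only [numBandwidths, K]
      push_cast
      nlinarith
    have hN' : (N n : ℝ) ≤ C * Real.log n ^ ν := by
      rw [div_le_iff₀ (by positivity)] at h1
      refine h1.trans ?_
      gcongr
      exact le_max_left _ _
    have hC : 0 ≤ C := le_max_right _ _
    have hK : 0 ≤ K := by positivity
    calc L * (N n * numBandwidths d a₀ n) / (n - trainSize n : ℕ) * (n : ℝ) ^ γ
        ≤ L * ((C * Real.log n ^ ν) * (K * Real.log n ^ 2)) / (n / Real.log n) *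
            (n : ℝ) ^ γ := by
          gcongr
      _ = _ := by
          rw [Real.rpow_sub hn0, Real.rpow_one, Real.rpow_add (by linarith),
            show Real.log n ^ (3 : ℝ) = Real.log n ^ 3 by exact_mod_cast Real.rpow_natCast _ 3]
          field_simp

/-! ### The smoothness grid. -/

/-- The index in the grid of the smallest smoothness at least `β`. -/
def smoothnessIndex (d : ℕ) (β : ℝ) (N : ℕ) : ℕ := ⌈(β - d / 2) * (N : ℝ) ^ (1 / 2 : ℝ)⌉₊

/-- The smallest smoothness in the grid which is at least `β`. -/
def gridSmoothness (d : ℕ) (β : ℝ) (N : ℕ) : ℝ :=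
  d / 2 + smoothnessIndex d β N * (N : ℝ) ^ (-(1 / 2 : ℝ))

theorem le_gridSmoothness {N : ℕ} (hN : 0 < N) : β ≤ gridSmoothness d β N := by
  have hN' : (0 : ℝ) < N := by exact_mod_cast hN
  have h1 := Nat.le_ceil ((β - d / 2) * (N : ℝ) ^ (1 / 2 : ℝ))
  have h2 : (0 : ℝ) < (N : ℝ) ^ (1 / 2 : ℝ) := by positivity
  rw [gridSmoothness, Real.rpow_neg hN'.le, ← div_eq_mul_inv]
  have := (le_div_iff₀ h2).2 h1
  unfold smoothnessIndex
  linarith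

theorem gridSmoothness_le (hβ : (d : ℝ) / 2 < β) {N : ℕ} (hN : 0 < N) :
    gridSmoothness d β N ≤ β + ((N : ℝ) ^ (1 / 2 : ℝ))⁻¹ := by
  have hN' : (0 : ℝ) < N := by exact_mod_cast hN
  have h2 : (0 : ℝ) < (N : ℝ) ^ (1 / 2 : ℝ) := by positivity
  have h1 := (Nat.ceil_lt_add_one
    (mul_nonneg (sub_pos.2 hβ).le h2.le : 0 ≤ (β - d / 2) * (N : ℝ) ^ (1 / 2 : ℝ))).le
  rw [gridSmoothness, Real.rpow_neg hN'.le]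
  unfold smoothnessIndex
  have h3 := mul_le_mul_of_nonneg_right h1 (inv_pos.2 h2).le
  rw [add_mul, mul_assoc, mul_inv_cancel₀ h2.ne'] at h3
  linarith

theorem tendsto_natCast_rpow_half :
    Tendsto (fun N : ℕ => (N : ℝ) ^ (1 / 2 : ℝ)) atTop atTop :=
  (tendsto_rpow_atTop (by norm_num)).comp tendsto_natCast_atTop_atTop

theorem tendsto_gridSmoothness (hβ : (d : ℝ) / 2 < β) :
    Tendsto (gridSmoothness d β) atTop (𝓝 β) := by
  have h1 : Tendsto (fun N : ℕ => β + ((N : ℝ) ^ (1 / 2 : ℝ))⁻¹) atTop (𝓝 (β + 0)) :=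
    tendsto_const_nhds.add tendsto_natCast_rpow_half.inv_tendsto_atTop
  rw [add_zero] at h1
  refine tendsto_of_tendsto_of_tendsto_of_le_of_le' tendsto_const_nhds h1 ?_ ?_
  · filter_upwards [eventually_gt_atTop 0] with N hN using le_gridSmoothness hN
  · filter_upwards [eventually_gt_atTop 0] with N hN using gridSmoothness_le hβ hN

/-- The mesh `N^{-1/2}` shrinks while the range, of order `N^{1/2}`, grows, so every `β > d/2` is
eventually covered. -/
theorem eventually_smoothnessIndex_lt (hβ : (d : ℝ) / 2 < β) :
    ∀ᶠ N : ℕ in atTop, smoothnessIndex d β N < N := by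
  filter_upwards [tendsto_natCast_rpow_half.eventually_gt_atTop (β - d / 2 + 1),
    eventually_gt_atTop 0] with N h1 hN
  have hN' : (1 : ℝ) ≤ N := by exact_mod_cast hN
  have h2 : (1 : ℝ) ≤ (N : ℝ) ^ (1 / 2 : ℝ) := Real.one_le_rpow hN' (by norm_num)
  have h3 := Nat.ceil_lt_add_one
    (mul_nonneg (sub_pos.2 hβ).le (by linarith) : 0 ≤ (β - d / 2) * (N : ℝ) ^ (1 / 2 : ℝ))
  have h4 : (N : ℝ) ^ (1 / 2 : ℝ) * (N : ℝ) ^ (1 / 2 : ℝ) = N := by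
    rw [← Real.rpow_add (by linarith)]; norm_num
  have h5 : (smoothnessIndex d β N : ℝ) < N := by
    unfold smoothnessIndex
    nlinarith
  exact_mod_cast h5

theorem tendsto_pinskerEnergy (hd : 1 ≤ d) (hβ : 0 < β) :
    Tendsto (pinskerEnergy d) (𝓝 β) (𝓝 (pinskerEnergy d β)) := by
  have h1 : (0 : ℝ) < d := by exact_mod_cast hd
  have h2 : ContinuousAt
      (fun b : ℝ => sphereSurface d * (2 * b ^ 2 / (d * (b + d) * (2 * b + d)))) β := by
    have : (d : ℝ) * (β + d) * (2 * β + d) ≠ 0 := by positivity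
    fun_prop (disch := assumption)
  rw [pinskerEnergy_eq hd hβ]
  refine Tendsto.congr' ?_ h2
  filter_upwards [eventually_gt_nhds hβ] with b hb
  rw [pinskerEnergy_eq hd hb]

/-! ### Comparison with the optimal bandwidth, and the limit of the bound. -/

/-- The optimal bandwidth. -/
def optimalBandwidth (d : ℕ) (β Q : ℝ) (n : ℕ) : ℝ :=
  (bandwidthConstant d β Q / n) ^ (1 / (2 * β + d))

theorem eventually_optimalBandwidth (hd : 1 ≤ d) (hβ : 0 < β) (hQ : 0 < Q) :
    ∀ᶠ n : ℕ in atTop, h0 d n ≤ optimalBandwidth d β Q n ∧ optimalBandwidth d β Q n < 1 := by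
  have h1 : (0 : ℝ) < d := by exact_mod_cast hd
  have hc := bandwidthConstant_pos hd hβ hQ
  set c := bandwidthConstant d β Q with hcdef
  have hexp : 0 < 1 / (d : ℝ) - 1 / (2 * β + d) := by
    have : 1 / (d : ℝ) - 1 / (2 * β + d) = 2 * β / (d * (2 * β + d)) := by field_simp; ring
    rw [this]
    positivity
  have e1 := ((tendsto_rpow_atTop hexp).comp tendsto_natCast_atTop_atTop (α := ℕ)).eventually_ge_atTop
    (c ^ (1 / (2 * β + d)))⁻¹
  filter_upwards [e1, eventually_ge_atTop 3,
    (tendsto_natCast_atTop_atTop (R := ℝ)).eventually_gt_atTop c] with n hn1 hn hnc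
  have hn0 : (0 : ℝ) < n := by exact_mod_cast (by omega : 0 < n)
  have hlog := one_lt_log hn
  constructor
  · have h2 : h0 d n ≤ (n : ℝ) ^ (-1 / (d : ℝ)) := by
      refine Real.rpow_le_rpow_of_nonpos hn0 ?_ ?_
      · nlinarith
      · rw [neg_div]
        have : 0 < 1 / (d : ℝ) := by positivity
        linarith
    refine h2.trans ?_
    have h3 : (n : ℝ) ^ (-1 / (d : ℝ)) =
        ((n : ℝ) ^ (1 / (2 * β + d)))⁻¹ * ((n : ℝ) ^ (1 / (d : ℝ) - 1 / (2 * β + d)))⁻¹ := by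
      rw [← Real.rpow_neg hn0.le, ← Real.rpow_neg hn0.le, ← Real.rpow_add hn0]
      congr 1
      ring
    rw [optimalBandwidth, Real.div_rpow hc.le hn0.le, h3, div_eq_mul_inv (c ^ _),
      mul_comm (c ^ _)]
    exact mul_le_mul_of_nonneg_left (inv_le_of_inv_le₀ (by positivity) hn1) (by positivity)
  · refine Real.rpow_lt_one (by positivity) ?_ (by positivity)
    rw [div_lt_one hn0]
    exact hnc

/-- The rescaled risk bound. -/
def rescaledBound (d : ℕ) (a₀ β Q : ℝ) (n N : ℕ) : ℝ :=
  ((2 * Real.pi) ^ d)⁻¹ * (bandwidthConstant d β Q ^ (2 * β / (2 * β + d)) * Q +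
    n / trainSize n * gridRatio a₀ n ^ d * (bandwidthConstant d β Q ^ (-(d / (2 * β + d))) *
      pinskerEnergy d (gridSmoothness d β N))) +
    sobolevSupBound d β Q * (N * numBandwidths d a₀ n) / (n - trainSize n : ℕ) *
      (n : ℝ) ^ (2 * β / (2 * β + d))

theorem tendsto_rescaledBound (hd : 1 ≤ d) {a₀ : ℝ} (ha : 0 < a₀) {N : ℕ → ℕ}
    (hN : Tendsto N atTop atTop) {ν : ℝ}
    (hNν : IsBoundedUnder (· ≤ ·) atTop fun n : ℕ => (N n : ℝ) / Real.log n ^ ν)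
    (hβ : (d : ℝ) / 2 < β) (hQ : 0 < Q) :
    Tendsto (fun n => rescaledBound d a₀ β Q n (N n)) atTop (𝓝 (pinskerConstant d β Q)) := by
  have h1 : (0 : ℝ) < d := by exact_mod_cast hd
  have hβ0 : 0 < β := lt_of_le_of_lt (by positivity) hβ
  have hγ : 2 * β / (2 * β + d) < 1 := by
    rw [div_lt_one (by positivity)]; linarith
  have t1 := tendsto_estimation_cost hd ha hNν
    (sobolevSupBound_nonneg (d := d) (β := β) hQ) hγ
  have t2 := (tendsto_pinskerEnergy hd hβ0).comp ((tendsto_gridSmoothness hβ).comp hN)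
  have t3 := (tendsto_gridRatio a₀).pow d
  have t4 := (((tendsto_div_trainSize.mul t3).mul (t2.const_mul
    (bandwidthConstant d β Q ^ (-((d : ℝ) / (2 * β + d)))))).const_add
    (bandwidthConstant d β Q ^ (2 * β / (2 * β + d)) * Q)).const_mul
    (((2 * Real.pi) ^ d)⁻¹)
  have t5 := t4.add t1
  rw [one_pow, one_mul, one_mul, add_zero, pinskerConstant_eq hd hβ0 hQ] at t5
  exact t5

/-- The bias bound increases with `h`, so undershooting the optimum is free there; the variance
bound grows by at most `(1 + a_n)^d`. The bandwidth is the one optimal for `β`, although the kernel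
has index `b ≥ β`. -/
theorem aggregateRiskBound_le (hd : 1 ≤ d) {a₀ : ℝ} (ha : 0 < a₀) (hβ : 0 < β) (hQ : 0 < Q)
    {n : ℕ} (hn : 3 ≤ n) (hm : 0 < trainSize n) {N : ℕ} {h : ℝ}
    (h1 : optimalBandwidth d β Q n / gridRatio a₀ n ≤ h) (h2 : h ≤ optimalBandwidth d β Q n) :
    aggregateRiskBound d a₀ β Q (gridSmoothness d β N) h n N ≤
      rescaledBound d a₀ β Q n N * (n : ℝ) ^ (-(2 * β / (2 * β + d))) := by
  have hd0 : (0 : ℝ) < d := by exact_mod_cast hd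
  have hn0 : (0 : ℝ) < n := by exact_mod_cast (by omega : 0 < n)
  have hm0 : (0 : ℝ) < trainSize n := by exact_mod_cast hm
  have hc := bandwidthConstant_pos hd hβ hQ
  have hg : 0 < gridRatio a₀ n := zero_lt_one.trans (gridRatio_gt_one ha (by omega))
  have hH : 0 < optimalBandwidth d β Q n := by unfold optimalBandwidth; positivity
  have hh : 0 < h := lt_of_lt_of_le (by positivity) h1
  have hE := pinskerEnergy_nonneg (d := d) (b := gridSmoothness d β N)
  set V := pinskerEnergy d (gridSmoothness d β N)
  set c := bandwidthConstant d β Q with hcdef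
  set γ := 2 * β / (2 * β + d) with hγ
  set H := optimalBandwidth d β Q n with hHdef
  have e1 : H ^ (2 * β) = c ^ γ * (n : ℝ) ^ (-γ) := by
    rw [hHdef, optimalBandwidth, ← Real.rpow_mul (by positivity), Real.div_rpow hc.le hn0.le,
      Real.rpow_neg hn0.le, div_eq_mul_inv, hγ]
    congr 2 <;> ring_nf
  have e2 : (H ^ d)⁻¹ = c ^ (-((d : ℝ) / (2 * β + d))) * (n * (n : ℝ) ^ (-γ)) := by
    rw [hHdef, optimalBandwidth, ← Real.rpow_natCast, ← Real.rpow_mul (by positivity),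
      Real.div_rpow hc.le hn0.le, inv_div, Real.rpow_neg hc.le, div_eq_mul_inv, mul_comm]
    congr 1
    · congr 2; ring
    · rw [← Real.rpow_one_add' hn0.le]
      · congr 1
        rw [hγ]; field_simp; ring
      · have : 1 + -γ = d / (2 * β + d) := by rw [hγ]; field_simp; ring
        rw [this]
        positivity
  have e3 : (h ^ d)⁻¹ ≤ gridRatio a₀ n ^ d * (H ^ d)⁻¹ := by
    have : (H / gridRatio a₀ n) ^ d ≤ h ^ d := by gcongr
    rw [div_pow] at this
    have h3 := inv_anti₀ (by positivity) this
    rw [inv_div, div_eq_mul_inv] at h3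
    exact h3
  have e4 : h ^ (2 * β) ≤ H ^ (2 * β) := Real.rpow_le_rpow hh.le h2 (by positivity)
  have e5 : (n : ℝ) ^ γ * (n : ℝ) ^ (-γ) = 1 := by
    rw [← Real.rpow_add hn0, add_neg_cancel, Real.rpow_zero]
  calc aggregateRiskBound d a₀ β Q (gridSmoothness d β N) h n N
      ≤ ((2 * Real.pi) ^ d)⁻¹ * (H ^ (2 * β) * Q +
          (trainSize n : ℝ)⁻¹ * (gridRatio a₀ n ^ d * (H ^ d)⁻¹) * V) +
          sobolevSupBound d β Q * (N * numBandwidths d a₀ n) / (n - trainSize n : ℕ) := by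
        unfold aggregateRiskBound kernelRiskBound
        gcongr
    _ = _ := by
        rw [e1, e2, rescaledBound, add_mul, mul_assoc _ _ ((n : ℝ) ^ (-γ)),
          mul_assoc _ ((n : ℝ) ^ γ), e5, mul_one]
        congr 1
        ring

theorem asymptoticallyLE_of_risk_le (hd : 1 ≤ d) {a₀ : ℝ} (ha : 0 < a₀) {N : ℕ → ℕ}
    (hN : Tendsto N atTop atTop) {ν : ℝ}
    (hNν : IsBoundedUnder (· ≤ ·) atTop fun n : ℕ => (N n : ℝ) / Real.log n ^ ν)
    (hβ : (d : ℝ) / 2 < β) (hQ : 0 < Q) {est : ∀ n : ℕ, (Fin n → E d) → E d → ℝ}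
    (h : ∀ n, 3 ≤ n → 0 < trainSize n → ∀ k : Fin (N n), β ≤ smoothnessGrid d (N n) k →
      ∀ j : Fin (numBandwidths d a₀ n), ∀ p ∈ sobolevClass d β Q, risk (est n) p ≤
        ENNReal.ofReal (aggregateRiskBound d a₀ β Q (smoothnessGrid d (N n) k)
          (bandwidth d a₀ n j) n (N n))) :
    AsymptoticallyLE (fun n => ⨆ p ∈ sobolevClass d β Q, risk (est n) p)
      (pinskerConstant d β Q) (2 * β / (2 * β + d)) := by
  have hβ0 : 0 < β := lt_of_le_of_lt (by positivity) hβ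
  have hC := pinskerConstant_pos hd hβ0 hQ
  -- This `ε` turns the final comparison into an identity. It does not involve `p`, and neither do
  -- the grid points selected below, hence the uniformity over the class.
  refine ⟨fun n => rescaledBound d a₀ β Q n (N n) / pinskerConstant d β Q - 1, ?_, ?_⟩
  · have := ((tendsto_rescaledBound hd ha hN hNν hβ hQ).div_const
      (pinskerConstant d β Q)).sub_const 1
    rwa [div_self hC.ne', sub_self] at this
  · have hm : ∀ᶠ n : ℕ in atTop, 0 < trainSize n := by
      -- Division by zero gives zero, so a positive quotient forces a nonempty training sample.
      filter_upwards [tendsto_div_trainSize.eventually (eventually_gt_nhds zero_lt_one)] with n hn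
      rcases Nat.eq_zero_or_pos (trainSize n) with h0 | h0
      · simp [h0] at hn
      · exact h0
    filter_upwards [hm, eventually_ge_atTop 3, hN.eventually (eventually_gt_atTop 0),
      hN.eventually (eventually_smoothnessIndex_lt hβ),
      eventually_optimalBandwidth hd hβ0 hQ] with n hmn hn hNn hk hH
    obtain ⟨j, hj1, hj2⟩ := exists_bandwidth hd ha hn hH.1 hH.2
    refine iSup₂_le fun p hp => ?_
    refine (h n hn hmn ⟨_, hk⟩ (le_gridSmoothness hNn) j p hp).trans
      (ENNReal.ofReal_le_ofReal ?_)
    refine (aggregateRiskBound_le hd ha hβ0 hQ hn hmn hj1 hj2).trans (le_of_eq ?_)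
    field_simp
    ring

end

end DensityAggregation

end

theorem corollary6p3 (d : ℕ) (hd : 1 ≤ d) (a₀ : ℝ) (ha₀ : 0 < a₀)
    (S : ∀ n : ℕ, Finset (DensityAggregation.Split n)) (hS : ∀ n : ℕ, 3 ≤ n → (S n).Nonempty)
    (N : ℕ → ℕ) (hN : Tendsto N atTop atTop) (ν : ℝ) (hν : 0 < ν)
    (hNν : IsBoundedUnder (· ≤ ·) atTop fun n : ℕ => (N n : ℝ) / Real.log n ^ ν)
    (β Q : ℝ) (hβ : (d : ℝ) / 2 < β) (hQ : 0 < Q) :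
    DensityAggregation.AsymptoticallyLE
      (fun n => ⨆ p ∈ DensityAggregation.sobolevClass d β Q,
        DensityAggregation.risk
          (DensityAggregation.averagedLinearAggregate d a₀ n (N n) (S n)) p)
      (DensityAggregation.pinskerConstant d β Q) (2 * β / (2 * β + d)) ∧
    DensityAggregation.AsymptoticallyLE
      (fun n => ⨆ p ∈ DensityAggregation.sobolevClass d β Q,
        DensityAggregation.risk
          (DensityAggregation.averagedConvexAggregate d a₀ n (N n) (S n)) p)
      (DensityAggregation.pinskerConstant d β Q) (2 * β / (2 * β + d)) := by
  refine ⟨DensityAggregation.asymptoticallyLE_of_risk_le hd ha₀ hN hNν hβ hQ ?_,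
    DensityAggregation.asymptoticallyLE_of_risk_le hd ha₀ hN hNν hβ hQ ?_⟩
  · exact fun n hn hm k hk j p hp => DensityAggregation.risk_averagedLinearAggregate_le hd ha₀ hβ
      hQ (by omega) hm (DensityAggregation.trainSize_lt hn) (hS n hn) k hk j hp
  · exact fun n hn hm k hk j p hp => DensityAggregation.risk_averagedConvexAggregate_le hd ha₀ hβ
      hQ (by omega) hm (DensityAggregation.trainSize_lt hn) (hS n hn) k hk j hp
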